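/- Let $\alpha,\eta,\theta,R$ be real $N\times N$ matrices with $\alpha=\alpha^{T}>0$, $\eta=\eta^{T}>0$ (the duality condition), $\theta^{T}=-\theta$, $R=R^{T}\ge 0$ and $N_R=\operatorname{rank}R>0$. For complex $\beta$ let $A(\beta)=\Omega-\mathrm{i}\beta B$ be the system operator on $\mathbb{C}^{2N}$ of $\alpha\ddot Q+(2\theta+\beta R)\dot Q+\eta Q=0$, where $$\Omega=\begin{bmatrix}-2\mathrm{i}K_{\mathrm p}\theta K_{\mathrm p}^{T}&-\mathrm{i}\Phi^{T}\\ \mathrm{i}\Phi&0\end{bmatrix},\quad B=\begin{bmatrix}K_{\mathrm p}RK_{\mathrm p}^{T}&0\\0&0\end{bmatrix},\quad K_{\mathrm p}=\sqrt{\alpha}^{\,-1},\ \Phi=\sqrt{\eta}\,K_{\mathrm p}^{T}.$$ Let $\omega_{\max}$ be the largest eigenvalue of $\Omega$ and let $b_1,\dots,b_{N_R}$ be the nonzero eigenvalues of $B$, repeated according to multiplicity, with $b_0=0$. Denote by $\Omega^{\flat},B^{\flat},\omega_{\max}^{\flat},b_j^{\flat}$ the same objects for the dual system, obtained by interchanging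 $\alpha$ and $\eta$. Assume the generic condition for both systems: $b_1,\dots,b_{N_R}$ are distinct and $b_1^{\flat},\dots,b_{N_R}^{\flat}$ are distinct. Put $$d=\min_{0\le i,j\le N_R,\ i\ne j}|b_i-b_j|,\quad d^{\flat}=\min_{0\le i,j\le N_R,\ i\ne j}|b_i^{\flat}-b_j^{\flat}|,\quad \beta_0=\frac{2\omega_{\max}}{d},\quad \beta_1=\max\Big\{\beta_0,\frac{2\omega_{\max}^{\flat}}{d^{\flat}}\Big\}.$$ (1) The high-loss eigenvalues $\zeta_1(\beta),\dots,\zeta_{N_R}(\beta)$ of $A(\beta)$, i.e. those eigenvalues (counted with algebraic multiplicity) that tend to infinity in modulus as $\beta\to+\infty$, the others staying bounded, are meromorphic in $z=\beta^{-1}$ at $z=0$, and are analytic in the punctured disc $0<|z|<\beta_0^{-1}$, where they are simple eigenvalues of $A(z^{-1})$. Their eigenprojections $P_j$ extend analytically to the whole disc $|z|<\beta_0^{-1}$ and have rank one there. If $\beta>\beta_0$ then $\operatorname{Re}\zeta_j(\beta)=0$ for $1\le j\le N_R$. (2) The low-loss/low-Q eigenvalues $\zeta_{N_R+1}(\beta),\dots,\zeta_{2N_R}(\beta)$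 of $A(\beta)$, i.e. those eigenvalues (counted with algebraic multiplicity) that tend to $0$ as $\beta\to+\infty$, the others staying away from $0$, are analytic in $z=\beta^{-1}$ in the disc $|z|<\beta_1^{-1}$ (with value $0$ at $z=0$). Their eigenprojections $P_j$ extend analytically to this disc, including $z=0$, and have rank one there; for $0<|z|<\beta_1^{-1}$ the eigenvalues are simple eigenvalues of $A(z^{-1})$. In particular, if $\beta>\beta_1$ then $\zeta_{N_R+1}(\beta),\dots,\zeta_{2N_R}(\beta)$ are simple eigenvalues of $A(\beta)$ and $\operatorname{Re}\zeta_j(\beta)=0$ for $N_R+1\le j\le 2N_R$. -/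

import Mathlib

open Matrix Filter Topology
open scoped MatrixOrder

noncomputable section

/-- A linear Lagrangian system `α Q'' + (2 θ + β R) Q' + η Q = 0` with `N` degrees of freedom:
the real matrices `α, η, θ, R` satisfy `α = αᵀ > 0`, `η = ηᵀ ≥ 0`, `θᵀ = -θ`, `R = Rᵀ ≥ 0`, and
`R` has positive rank. -/
structure LagrangianSystem (N : ℕ) where
  α : Matrix (Fin N) (Fin N) ℝ
  η : Matrix (Fin N) (Fin N) ℝ
  θ : Matrix (Fin N) (Fin N) ℝ
  R : Matrix (Fin N) (Fin N) ℝ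
  α_pos : α.PosDef
  η_nonneg : η.PosSemidef
  θ_skew : θᵀ = -θ
  R_nonneg : R.PosSemidef
  R_rank_pos : 0 < R.rank

namespace LagrangianSystem

variable {N : ℕ}

/-- The dual system, obtained by interchanging `α` and `η`; it is defined when `η > 0`. -/
def dual (S : LagrangianSystem N) (hη : S.η.PosDef) : LagrangianSystem N where
  α := S.η
  η := S.α
  θ := S.θ
  R := S.R
  α_pos := hη
  η_nonneg := S.α_pos.posSemidef
  θ_skew := S.θ_skew
  R_nonneg := S.R_nonneg
  R_rank_pos := S.R_rank_pos

/-- `N_R = rank R`. -/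
def rankR (S : LagrangianSystem N) : ℕ := S.R.rank

/-- `K_p = (√α)⁻¹`, with `√α` the positive definite square root. -/
def Kp (S : LagrangianSystem N) : Matrix (Fin N) (Fin N) ℝ := (CFC.sqrt S.α)⁻¹

/-- `K_q = √η`, the positive semidefinite square root. -/
def Kq (S : LagrangianSystem N) : Matrix (Fin N) (Fin N) ℝ := CFC.sqrt S.η

/-- `Φ = K_q K_pᵀ`. -/
def Phi (S : LagrangianSystem N) : Matrix (Fin N) (Fin N) ℝ := S.Kq * S.Kpᵀ

/-- The frequency operator
`Ω = [[-2i K_p θ K_pᵀ, -i Φᵀ], [i Φ, 0]]`. -/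
def Omega (S : LagrangianSystem N) : Matrix (Fin N ⊕ Fin N) (Fin N ⊕ Fin N) ℂ :=
  Matrix.fromBlocks
    ((-2 * Complex.I) • (S.Kp * S.θ * S.Kpᵀ).map Complex.ofReal)
    ((-Complex.I) • S.Phiᵀ.map Complex.ofReal)
    (Complex.I • S.Phi.map Complex.ofReal)
    0

/-- The power dissipation operator `B = [[K_p R K_pᵀ, 0], [0, 0]]`. -/
def B (S : LagrangianSystem N) : Matrix (Fin N ⊕ Fin N) (Fin N ⊕ Fin N) ℂ :=
  Matrix.fromBlocks ((S.Kp * S.R * S.Kpᵀ).map Complex.ofReal) 0 0 0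

/-- The system operator `A(β) = Ω - i β B`, for complex `β`. -/
def A (S : LagrangianSystem N) (β : ℂ) : Matrix (Fin N ⊕ Fin N) (Fin N ⊕ Fin N) ℂ :=
  S.Omega - (Complex.I * β) • S.B

/-- `ω_max`, the largest eigenvalue of the Hermitian matrix `Ω`. -/
def omegaMax (S : LagrangianSystem N) : ℝ :=
  sSup {ω : ℝ | (ω : ℂ) ∈ spectrum ℂ S.Omega}

/-- `B₂`, the restriction of `B` to its range (the loss subspace). -/
def B₂ (S : LagrangianSystem N) :
    LinearMap.range (Matrix.toLin' S.B) →ₗ[ℂ] LinearMap.range (Matrix.toLin' S.B) :=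
  (Matrix.toLin' S.B).restrict (fun x _ => LinearMap.mem_range_self (Matrix.toLin' S.B) x)

/-- The generic condition: the eigenvalues `b₁, …, b_{N_R}` of `B₂`, repeated according to
multiplicity, are distinct. -/
def Generic (S : LagrangianSystem N) : Prop := S.B₂.charpoly.roots.Nodup

/-- `d`, the minimal distance between two different eigenvalues of `B` (including `b₀ = 0`). -/
def gap (S : LagrangianSystem N) : ℝ :=
  sInf {x : ℝ | ∃ b ∈ spectrum ℂ S.B, ∃ b' ∈ spectrum ℂ S.B, b ≠ b' ∧ x = ‖b - b'‖}

/-- `β₀ = 2 ω_max / d`. -/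
def beta0 (S : LagrangianSystem N) : ℝ := 2 * S.omegaMax / S.gap

/-- `β₁ = max {β₀, 2 ω♭_max / d♭}`. -/
def beta1 (S : LagrangianSystem N) (hη : S.η.PosDef) : ℝ :=
  max S.beta0 (2 * (S.dual hη).omegaMax / (S.dual hη).gap)

/-- The functions `ζ j` of `z = β⁻¹` are the high-loss eigenvalues, counted with algebraic
multiplicity: as `β → ∞` they tend to infinity in modulus, and all other eigenvalues of `A(β)`
stay bounded. -/
def IsHighLossFamily (S : LagrangianSystem N) {n : ℕ} (ζ : Fin n → ℂ → ℂ) : Prop :=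
  (∀ j, Tendsto (fun β : ℝ => ‖ζ j ((β : ℂ)⁻¹)‖) atTop atTop) ∧
  ∃ r : ℝ, ∀ᶠ β : ℝ in atTop,
    (S.A (β : ℂ)).charpoly.roots.filter (fun x => r < ‖x‖)
      = Finset.univ.val.map (fun j => ζ j ((β : ℂ)⁻¹))

/-- The functions `ζ j` of `z = β⁻¹` are the low-loss/low-Q eigenvalues, counted with algebraic
multiplicity: as `β → ∞` they tend to `0`, and all other eigenvalues of `A(β)` stay away
from `0`. -/
def IsLowLossLowQFamily (S : LagrangianSystem N) {n : ℕ} (ζ : Fin n → ℂ → ℂ) : Prop :=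
  (∀ j, Tendsto (fun β : ℝ => ζ j ((β : ℂ)⁻¹)) atTop (𝓝 0)) ∧
  ∃ r : ℝ, 0 < r ∧ ∀ᶠ β : ℝ in atTop,
    (S.A (β : ℂ)).charpoly.roots.filter (fun x => ‖x‖ < r)
      = Finset.univ.val.map (fun j => ζ j ((β : ℂ)⁻¹))

end LagrangianSystem

/-- `x` is a simple eigenvalue of `M` (algebraic multiplicity one). -/
def IsSimpleEigenvalue {n : Type*} [Fintype n] [DecidableEq n] (M : Matrix n n ℂ) (x : ℂ) : Prop :=
  M.charpoly.rootMultiplicity x = 1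

/-- `P` is the eigenprojection of `M` for the eigenvalue `x`: the projection commuting with `M`
whose range is the algebraic (generalized) eigenspace. -/
def IsEigenprojection {n : Type*} [Fintype n] [DecidableEq n]
    (M : Matrix n n ℂ) (x : ℂ) (P : Matrix n n ℂ) : Prop :=
  P * P = P ∧ M * P = P * M ∧
  LinearMap.range (Matrix.toLin' P) = Module.End.maxGenEigenspace (Matrix.toLin' M) x

end

noncomputable section

section CharpolyRoots

variable {n : Type*} [Fintype n] [DecidableEq n]

/-- Over an algebraically closed field, `det (x - M)` is the product of `x - r` over the
eigenvalues `r` of `M`. -/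
lemma Matrix.det_scalar_sub_eq_prod_roots (M : Matrix n n ℂ) (x : ℂ) :
    (Matrix.scalar n x - M).det = (M.charpoly.roots.map (fun r => x - r)).prod := by
  rw [← Matrix.eval_charpoly]
  conv_lhs => rw [(IsAlgClosed.splits M.charpoly).eq_prod_roots_of_monic M.charpoly_monic]
  rw [Polynomial.eval_multiset_prod, Multiset.map_map]
  simp

lemma Matrix.card_roots_charpoly (M : Matrix n n ℂ) :
    Multiset.card M.charpoly.roots = Fintype.card n := by
  rw [← (IsAlgClosed.splits M.charpoly).natDegree_eq_card_roots, M.charpoly_natDegree_eq_dim]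

lemma Multiset.prod_map_mul_sub (c x : ℂ) (s : Multiset ℂ) :
    (s.map (fun r => c * (x - r))).prod = c ^ Multiset.card s * (s.map (fun r => x - r)).prod := by
  rw [Multiset.prod_map_mul]
  simp

/-- A matrix whose determinant `det (x - M)` agrees with `∏ (x - r)` for all `x ≠ 0` has the `r`
as its eigenvalues. -/
lemma Matrix.roots_charpoly_eq_of_det (M : Matrix n n ℂ) (s : Multiset ℂ)
    (h : ∀ x : ℂ, x ≠ 0 → (Matrix.scalar n x - M).det = (s.map (fun r => x - r)).prod) :
    M.charpoly.roots = s := by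
  have : M.charpoly = (s.map (fun r => Polynomial.X - Polynomial.C r)).prod := by
    apply Polynomial.eq_of_infinite_eval_eq
    refine Set.Infinite.mono (s := {0}ᶜ) ?_ (Set.finite_singleton (0 : ℂ)).infinite_compl
    intro x hx
    have hx' : x ≠ 0 := hx
    simp only [Set.mem_ofPred_eq]
    rw [Matrix.eval_charpoly, h x hx', Polynomial.eval_multiset_prod, Multiset.map_map]
    simp
  rw [this, Polynomial.roots_multiset_prod_X_sub_C]

lemma Matrix.roots_charpoly_smul (M : Matrix n n ℂ) {c : ℂ} (hc : c ≠ 0) :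
    (c • M).charpoly.roots = M.charpoly.roots.map (fun r => c * r) := by
  apply Matrix.roots_charpoly_eq_of_det
  intro x _
  have h1 : Matrix.scalar n x - c • M = c • (Matrix.scalar n (c⁻¹ * x) - M) := by
    ext i j
    by_cases hij : i = j
    · subst hij
      simp [mul_sub, hc]
    · simp [hij]
  rw [h1, Matrix.det_smul, Matrix.det_scalar_sub_eq_prod_roots, ← Matrix.card_roots_charpoly M,
    ← Multiset.prod_map_mul_sub, Multiset.map_map]
  congr 1
  apply Multiset.map_congr rfl
  intro r _
  simp only [Function.comp]
  field_simp

/-- If `M' M = -1` then the eigenvalues of `M'` are the `-1/r`, for `r` the eigenvalues of `M`. -/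
lemma Matrix.roots_charpoly_of_mul_eq_neg_one {M M' : Matrix n n ℂ} (h : M' * M = -1) :
    M'.charpoly.roots = M.charpoly.roots.map (fun r => -r⁻¹) := by
  have hdet : M.det ≠ 0 := by
    intro h0
    have := congrArg Matrix.det h
    rw [Matrix.det_mul, h0, mul_zero, Matrix.det_neg, Matrix.det_one, mul_one] at this
    exact pow_ne_zero _ (by norm_num) this.symm
  have hr : ∀ r ∈ M.charpoly.roots, r ≠ 0 := by
    rintro r hr rfl
    apply hdet
    rw [Matrix.det_eq_prod_roots_charpoly]
    exact Multiset.prod_eq_zero hr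
  apply Matrix.roots_charpoly_eq_of_det
  intro x hx
  apply mul_right_cancel₀ hdet
  have h1 : (Matrix.scalar n x - M') * M = (-x) • (Matrix.scalar n (-x⁻¹) - M) := by
    rw [sub_mul, h]
    ext i j
    by_cases hij : i = j
    · subst hij
      simp [Matrix.scalar_apply, mul_sub, hx]
      ring
    · simp [Matrix.scalar_apply, hij]
  rw [← Matrix.det_mul, h1, Matrix.det_smul, Matrix.det_scalar_sub_eq_prod_roots,
    ← Matrix.card_roots_charpoly M, ← Multiset.prod_map_mul_sub, Multiset.map_map,
    Matrix.det_eq_prod_roots_charpoly]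
  conv_rhs => rw [← Multiset.map_id M.charpoly.roots, Multiset.map_map]
  rw [← Multiset.prod_map_mul]
  congr 1
  apply Multiset.map_congr rfl
  intro r hrm
  have := hr r hrm
  simp only [Function.comp, id]
  field_simp
  ring

lemma isSimpleEigenvalue_iff_count {M : Matrix n n ℂ} {x : ℂ} :
    IsSimpleEigenvalue M x ↔ M.charpoly.roots.count x = 1 := by
  rw [IsSimpleEigenvalue, Polynomial.count_roots]

end CharpolyRoots

section Eigenprojection

variable {n : Type*} [Fintype n] [DecidableEq n]

/-- The eigenprojection `adj (x - M) / χ'(x)` of a simple eigenvalue `x` of `M`. -/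
def adjugateProj (M : Matrix n n ℂ) (x : ℂ) : Matrix n n ℂ :=
  (M.charpoly.derivative.eval x)⁻¹ • (Matrix.scalar n x - M).adjugate

lemma IsSimpleEigenvalue.isRoot {M : Matrix n n ℂ} {x : ℂ} (h : IsSimpleEigenvalue M x) :
    M.charpoly.IsRoot x := by
  rw [← Polynomial.rootMultiplicity_pos M.charpoly_monic.ne_zero, h]
  exact one_pos

lemma IsSimpleEigenvalue.det_eq_zero {M : Matrix n n ℂ} {x : ℂ} (h : IsSimpleEigenvalue M x) :
    (Matrix.scalar n x - M).det = 0 := by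
  rw [← Matrix.eval_charpoly]
  exact h.isRoot

lemma IsSimpleEigenvalue.derivative_ne_zero {M : Matrix n n ℂ} {x : ℂ}
    (h : IsSimpleEigenvalue M x) : M.charpoly.derivative.eval x ≠ 0 := by
  intro h0
  have := (Polynomial.one_lt_rootMultiplicity_iff_isRoot M.charpoly_monic.ne_zero).2 ⟨h.isRoot, h0⟩
  rw [h] at this
  exact lt_irrefl _ this

/-- Derivative of the identity `(x - M) adj (x - M) = χ(x)` in `x`. -/
lemma Matrix.exists_adjugate_add_mul_eq (M : Matrix n n ℂ) (x : ℂ) :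
    ∃ D : Matrix n n ℂ, (Matrix.scalar n x - M).adjugate + (Matrix.scalar n x - M) * D
      = (M.charpoly.derivative.eval x) • 1 := by
  have hev : (charmatrix M).map (Polynomial.eval x) = Matrix.scalar n x - M := by
    ext i j
    by_cases hij : i = j
    · subst hij; simp
    · simp [hij]
  have hadj : (charmatrix M).adjugate.map (Polynomial.eval x)
      = (Matrix.scalar n x - M).adjugate := by
    rw [← hev]
    exact RingHom.map_adjugate (Polynomial.evalRingHom x) (charmatrix M)
  refine ⟨(charmatrix M).adjugate.map (fun p => (Polynomial.derivative p).eval x), ?_⟩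
  rw [← hadj]
  ext i j
  have h := congrFun (congrFun (Matrix.mul_adjugate (charmatrix M)) i) j
  have h' := congrArg (fun p => (Polynomial.derivative p).eval x) h
  have hd : ∀ k, Polynomial.derivative (charmatrix M i k) = if i = k then 1 else 0 := by
    intro k
    by_cases hik : i = k
    · subst hik; simp
    · simp [hik]
  simp only [Matrix.mul_apply, Polynomial.derivative_sum, Polynomial.derivative_mul, hd,
    Polynomial.eval_finsetSum, Polynomial.eval_add, Polynomial.eval_mul, Finset.sum_add_distrib]
    at h'
  have h1 : ∀ k, Polynomial.eval x (if i = k then (1 : Polynomial ℂ) else 0)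
      = if i = k then 1 else 0 := by
    intro k; split_ifs <;> simp
  simp only [h1, ite_mul, one_mul, zero_mul, Finset.sum_ite_eq, Finset.mem_univ, if_true] at h'
  have h2 : ∀ k, Polynomial.eval x (charmatrix M i k) = (Matrix.scalar n x - M) i k := by
    intro k; rw [← hev]; rfl
  simp only [h2] at h'
  rw [Matrix.add_apply, Matrix.mul_apply]
  simp only [Matrix.map_apply]
  rw [h']
  by_cases hij : i = j
  · subst hij; simp [Matrix.charpoly]
  · simp [hij]

lemma mul_adjugateProj {M : Matrix n n ℂ} {x : ℂ} (h : IsSimpleEigenvalue M x) :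
    M * adjugateProj M x = x • adjugateProj M x := by
  have h1 := Matrix.mul_adjugate (Matrix.scalar n x - M)
  rw [h.det_eq_zero, zero_smul, sub_mul, sub_eq_zero] at h1
  rw [adjugateProj, Matrix.mul_smul, ← h1, smul_comm, Matrix.scalar_apply, ← Matrix.smul_one_eq_diagonal,
    Matrix.smul_mul, one_mul, smul_comm]

lemma adjugateProj_mul {M : Matrix n n ℂ} {x : ℂ} (h : IsSimpleEigenvalue M x) :
    adjugateProj M x * M = x • adjugateProj M x := by
  have h1 := Matrix.adjugate_mul (Matrix.scalar n x - M)
  rw [h.det_eq_zero, zero_smul, mul_sub, sub_eq_zero] at h1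
  rw [adjugateProj, Matrix.smul_mul, ← h1, smul_comm, Matrix.scalar_apply, ← Matrix.smul_one_eq_diagonal,
    Matrix.mul_smul, mul_one, smul_comm]

lemma adjugateProj_mul_self {M : Matrix n n ℂ} {x : ℂ} (h : IsSimpleEigenvalue M x) :
    adjugateProj M x * adjugateProj M x = adjugateProj M x := by
  obtain ⟨D, hD⟩ := Matrix.exists_adjugate_add_mul_eq M x
  have h1 := Matrix.adjugate_mul (Matrix.scalar n x - M)
  rw [h.det_eq_zero, zero_smul] at h1
  have h2 := congrArg (fun Z => (Matrix.scalar n x - M).adjugate * Z) hD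
  simp only [mul_add, ← mul_assoc, h1, zero_mul, add_zero] at h2
  rw [adjugateProj, Matrix.smul_mul, Matrix.mul_smul, h2, Matrix.mul_smul, mul_one]
  rw [inv_smul_smul₀ h.derivative_ne_zero]

lemma adjugateProj_ne_zero {M : Matrix n n ℂ} {x : ℂ} (h : IsSimpleEigenvalue M x) :
    adjugateProj M x ≠ 0 := by
  intro h0
  obtain ⟨D, hD⟩ := Matrix.exists_adjugate_add_mul_eq M x
  have hadj : (Matrix.scalar n x - M).adjugate = 0 := by
    rw [adjugateProj] at h0
    exact (smul_eq_zero.1 h0).resolve_left (inv_ne_zero h.derivative_ne_zero)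
  rw [hadj, zero_add] at hD
  have := congrArg Matrix.det hD
  rw [Matrix.det_mul, h.det_eq_zero, zero_mul, Matrix.det_smul, Matrix.det_one, mul_one] at this
  exact pow_ne_zero _ h.derivative_ne_zero this.symm

/-- For a simple eigenvalue `x`, a nonzero matrix `P` with `M P = x P` has rank one, and its range
is the generalized eigenspace. -/
lemma IsSimpleEigenvalue.range_eq {M P : Matrix n n ℂ} {x : ℂ} (h : IsSimpleEigenvalue M x)
    (hP : P ≠ 0) (hMP : M * P = x • P) :
    LinearMap.range (Matrix.toLin' P) = Module.End.maxGenEigenspace (Matrix.toLin' M) x ∧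
      P.rank = 1 := by
  have hle : LinearMap.range (Matrix.toLin' P) ≤
      Module.End.maxGenEigenspace (Matrix.toLin' M) x := by
    rintro _ ⟨v, rfl⟩
    apply (Module.End.genEigenspace (Matrix.toLin' M) x).monotone (show (1 : ℕ∞) ≤ ⊤ from le_top)
    rw [Module.End.genEigenspace_one, LinearMap.mem_ker]
    simp only [LinearMap.sub_apply, Matrix.toLin'_apply, Matrix.mulVec_mulVec, hMP]
    simp [Matrix.smul_mulVec]
  have h1 : Module.finrank ℂ (Module.End.maxGenEigenspace (Matrix.toLin' M) x) = 1 := by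
    rw [LinearMap.finrank_maxGenEigenspace_eq, Matrix.charpoly_toLin', h]
  have hne : LinearMap.range (Matrix.toLin' P) ≠ ⊥ := by
    intro h0
    apply hP
    rw [LinearMap.range_eq_bot] at h0
    exact (LinearEquiv.map_eq_zero_iff _).1 h0
  have h2 : 1 ≤ Module.finrank ℂ (LinearMap.range (Matrix.toLin' P)) :=
    Submodule.one_le_finrank_iff.2 hne
  have heq := Submodule.eq_of_le_of_finrank_le hle (by omega)
  refine ⟨heq, ?_⟩
  rw [Matrix.rank, ← Matrix.toLin'_apply', heq, h1]

lemma IsSimpleEigenvalue.isEigenprojection {M P : Matrix n n ℂ} {x : ℂ}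
    (h : IsSimpleEigenvalue M x) (hP : P ≠ 0) (hPP : P * P = P) (hMP : M * P = x • P)
    (hPM : P * M = x • P) : IsEigenprojection M x P :=
  ⟨hPP, hMP.trans hPM.symm, (h.range_eq hP hMP).1⟩

lemma rank_adjugateProj {M : Matrix n n ℂ} {x : ℂ} (h : IsSimpleEigenvalue M x) :
    (adjugateProj M x).rank = 1 :=
  (h.range_eq (adjugateProj_ne_zero h) (mul_adjugateProj h)).2

end Eigenprojection

section HermitianBounds

variable {n : Type*} [Fintype n] [DecidableEq n] {M : Matrix n n ℂ}

lemma Matrix.IsHermitian.inner_eigenvectorBasis_sub (hM : M.IsHermitian) (x : ℂ) (v : n → ℂ)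
    (i : n) : inner ℂ (hM.eigenvectorBasis i) (WithLp.toLp 2 (x • v - M *ᵥ v))
      = (x - hM.eigenvalues i) * inner ℂ (hM.eigenvectorBasis i) (WithLp.toLp 2 v) := by
  have hs := (Matrix.isSymmetric_toEuclideanLin_iff.2 hM) (hM.eigenvectorBasis i) (WithLp.toLp 2 v)
  have h1 : Matrix.toEuclideanLin M (WithLp.toLp 2 v) = WithLp.toLp 2 (M *ᵥ v) := rfl
  have h2 : Matrix.toEuclideanLin M (hM.eigenvectorBasis i)
      = (hM.eigenvalues i : ℂ) • hM.eigenvectorBasis i := by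
    have h := hM.mulVec_eigenvectorBasis i
    ext j
    exact congrFun h j
  rw [h1, h2, inner_smul_left, Complex.conj_ofReal] at hs
  rw [WithLp.toLp_sub, WithLp.toLp_smul, inner_sub_right, inner_smul_right, ← hs]
  ring

/-- The resolvent bound `dist (x, σ(M)) ‖v‖ ≤ ‖(x - M) v‖` for a Hermitian matrix `M`. -/
lemma Matrix.IsHermitian.mul_norm_le_norm_sub (hM : M.IsHermitian) {x : ℂ} {δ : ℝ} (hδ : 0 ≤ δ)
    (h : ∀ i, δ ≤ ‖x - hM.eigenvalues i‖) (v : n → ℂ) :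
    δ * ‖WithLp.toLp 2 v‖ ≤ ‖WithLp.toLp 2 (x • v - M *ᵥ v)‖ := by
  apply le_of_sq_le_sq _ (norm_nonneg _)
  rw [mul_pow, ← hM.eigenvectorBasis.sum_sq_norm_inner_right (WithLp.toLp 2 v),
    ← hM.eigenvectorBasis.sum_sq_norm_inner_right, Finset.mul_sum]
  apply Finset.sum_le_sum
  intro i _
  rw [hM.inner_eigenvectorBasis_sub, norm_mul, mul_pow]
  gcongr
  exact h i

/-- The operator norm of a Hermitian matrix is at most the largest modulus of its eigenvalues. -/
lemma Matrix.IsHermitian.norm_mulVec_le (hM : M.IsHermitian) {δ : ℝ} (hδ : 0 ≤ δ)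
    (h : ∀ i, |hM.eigenvalues i| ≤ δ) (v : n → ℂ) :
    ‖WithLp.toLp 2 (M *ᵥ v)‖ ≤ δ * ‖WithLp.toLp 2 v‖ := by
  have h0 : ‖WithLp.toLp 2 (M *ᵥ v)‖ = ‖WithLp.toLp 2 ((0 : ℂ) • v - M *ᵥ v)‖ := by
    rw [zero_smul, zero_sub, WithLp.toLp_neg, norm_neg]
  rw [h0]
  apply le_of_sq_le_sq _ (by positivity)
  rw [mul_pow, ← hM.eigenvectorBasis.sum_sq_norm_inner_right (WithLp.toLp 2 v),
    ← hM.eigenvectorBasis.sum_sq_norm_inner_right, Finset.mul_sum]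
  apply Finset.sum_le_sum
  intro i _
  rw [hM.inner_eigenvectorBasis_sub, norm_mul, mul_pow]
  gcongr
  simpa using h i

/-- Every eigenvalue of `M + z C`, for `M` Hermitian, is within `‖z‖ ‖C‖` of the spectrum of `M`. -/
lemma Matrix.IsHermitian.exists_eigenvalue_near (hM : M.IsHermitian) {C : Matrix n n ℂ} {ω : ℝ}
    (hC : ∀ v : n → ℂ, ‖WithLp.toLp 2 (C *ᵥ v)‖ ≤ ω * ‖WithLp.toLp 2 v‖) {z x : ℂ}
    (hx : (M + z • C).charpoly.IsRoot x) :
    ∃ i, ‖x - hM.eigenvalues i‖ ≤ ‖z‖ * ω := by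
  rw [Polynomial.IsRoot, Matrix.eval_charpoly, ← Matrix.exists_mulVec_eq_zero_iff] at hx
  obtain ⟨v, hv, hxv⟩ := hx
  have hv' : 0 < ‖WithLp.toLp 2 v‖ := norm_pos_iff.2 (by simpa using hv)
  have h1 : x • v - M *ᵥ v = z • (C *ᵥ v) := by
    rw [Matrix.sub_mulVec, Matrix.add_mulVec, Matrix.smul_mulVec, Matrix.scalar_apply,
      ← Matrix.smul_one_eq_diagonal, Matrix.smul_mulVec, Matrix.one_mulVec] at hxv
    rw [← sub_eq_zero, sub_sub, hxv]
  have hne : Nonempty n := by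
    by_contra hn
    rw [not_nonempty_iff] at hn
    exact hv (Subsingleton.elim _ _)
  obtain ⟨i, hi⟩ := Finite.exists_min (fun i => ‖x - hM.eigenvalues i‖)
  refine ⟨i, ?_⟩
  have h2 := hM.mul_norm_le_norm_sub (norm_nonneg _) hi v
  rw [h1, WithLp.toLp_smul, norm_smul] at h2
  have h3 := mul_le_mul_of_nonneg_left (hC v) (norm_nonneg z)
  apply le_of_mul_le_mul_right _ hv'
  linarith

end HermitianBounds

section RootCount

open Metric

lemma circleIntegral_sub_inv {c w : ℂ} {R : ℝ} (hR : 0 ≤ R) (hw : w ∉ sphere c R) :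
    (∮ x in C(c, R), (x - w)⁻¹) = if dist w c < R then 2 * Real.pi * Complex.I else 0 := by
  split_ifs with h
  · exact circleIntegral.integral_sub_inv_of_mem_ball h
  · have hw' : w ∉ closedBall c R := by
      rw [← ball_union_sphere]
      rintro (h1 | h1)
      · exact h h1
      · exact hw h1
    have hne : ∀ x ∈ closedBall c R, x - w ≠ 0 := by
      intro x hx h0
      rw [sub_eq_zero] at h0
      exact hw' (h0 ▸ hx)
    apply Complex.circleIntegral_eq_zero_of_differentiable_on_off_countable hR
      Set.countable_empty
    · exact ContinuousOn.inv₀ (by fun_prop) hne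
    · intro z hz
      exact DifferentiableAt.inv (by fun_prop) (hne z (ball_subset_closedBall hz.1))

lemma circleIntegral_sum_sub_inv {c : ℂ} {R : ℝ} (hR : 0 ≤ R) (s : Multiset ℂ)
    (hs : ∀ r ∈ s, r ∉ sphere c R) :
    CircleIntegrable (fun x => (s.map (fun r => (x - r)⁻¹)).sum) c R ∧
    (∮ x in C(c, R), (s.map (fun r => (x - r)⁻¹)).sum)
      = 2 * Real.pi * Complex.I * (s.countP (dist · c < R) : ℕ) := by
  classical
  induction s using Multiset.induction with
  | empty => simp [circleIntegral]
  | cons a s ih =>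
    obtain ⟨ih1, ih2⟩ := ih (fun r hr => hs r (Multiset.mem_cons_of_mem hr))
    have ha := hs a (Multiset.mem_cons_self a s)
    have hi : CircleIntegrable (fun x => (x - a)⁻¹) c R := by
      apply ContinuousOn.circleIntegrable hR
      refine ContinuousOn.inv₀ (by fun_prop) ?_
      intro x hx h0
      rw [sub_eq_zero] at h0
      exact ha (h0 ▸ hx)
    simp only [Multiset.map_cons, Multiset.sum_cons]
    refine ⟨hi.add ih1, ?_⟩
    rw [circleIntegral.integral_add hi ih1, ih2, circleIntegral_sub_inv hR ha,
      Multiset.countP_cons]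
    split_ifs <;> push_cast <;> ring

/-- The argument principle for a polynomial. -/
lemma Polynomial.circleIntegral_logDeriv {p : Polynomial ℂ} {c : ℂ} {R : ℝ} (hR : 0 ≤ R)
    (hp : ∀ x ∈ sphere c R, p.eval x ≠ 0) :
    (∮ x in C(c, R), p.derivative.eval x / p.eval x)
      = 2 * Real.pi * Complex.I * (p.roots.countP (dist · c < R) : ℕ) := by
  rw [← (circleIntegral_sum_sub_inv hR p.roots ?_).2]
  · apply circleIntegral.integral_congr hR
    intro x hx
    simp only
    rw [(IsAlgClosed.splits p).eval_derivative_div_eval_of_ne_zero (hp x hx)]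
    simp
  · intro r hr hr'
    exact hp r hr' (Polynomial.isRoot_of_mem_roots hr)

/-- A polynomial in two variables is smooth. -/
lemma Polynomial.contDiff_eval_map_eval (G : Polynomial (Polynomial ℂ)) :
    ContDiff ℂ 1 (fun p : ℂ × ℂ => (G.map (Polynomial.evalRingHom p.1)).eval p.2) := by
  have : (fun p : ℂ × ℂ => (G.map (Polynomial.evalRingHom p.1)).eval p.2)
      = fun p => ∑ i ∈ Finset.range (G.natDegree + 1), (G.coeff i).eval p.1 * p.2 ^ i := by
    funext p
    rw [Polynomial.eval_map, Polynomial.eval₂_eq_sum_range]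
    simp
  rw [this]
  apply ContDiff.sum
  intro i _
  apply ContDiff.mul
  · have := (G.coeff i).differentiable.contDiff (n := 1)
    simpa using! this.comp contDiff_fst
  · exact contDiff_snd.pow i

/-- The number of roots in a disc is constant along a connected polynomial family without roots on
the boundary circle. -/
lemma Polynomial.countP_roots_const (G : Polynomial (Polynomial ℂ)) {c : ℂ} {R : ℝ} (hR : 0 ≤ R)
    {U : Set ℂ} (hU : IsPreconnected U)
    (hG : ∀ z ∈ U, ∀ x ∈ sphere c R, (G.map (Polynomial.evalRingHom z)).eval x ≠ 0)
    {z w : ℂ} (hz : z ∈ U) (hw : w ∈ U) :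
    (G.map (Polynomial.evalRingHom z)).roots.countP (dist · c < R)
      = (G.map (Polynomial.evalRingHom w)).roots.countP (dist · c < R) := by
  refine hU.constant (f := fun z =>
    (G.map (Polynomial.evalRingHom z)).roots.countP (dist · c < R)) ?_ hz hw
  rw [continuousOn_iff_continuous_domRestrict,
    Nat.isClosedEmbedding_coe_real.isEmbedding.continuous_iff]
  have hcont : Continuous (fun z : U => ∮ x in C(c, R),
      (G.map (Polynomial.evalRingHom (z : ℂ))).derivative.eval x /
        (G.map (Polynomial.evalRingHom (z : ℂ))).eval x) := by
    unfold circleIntegral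
    apply intervalIntegral.continuous_parametric_intervalIntegral_of_continuous'
    have h1 : Continuous (fun p : U × ℝ => ((p.1 : ℂ), circleMap c R p.2)) := by fun_prop
    have h2 := (Polynomial.contDiff_eval_map_eval G).continuous.comp h1
    have h3 := (Polynomial.contDiff_eval_map_eval G.derivative).continuous.comp h1
    simp only [deriv_circleMap, Function.uncurry_def, Polynomial.derivative_map]
    have h4 : Continuous (fun p : U × ℝ => circleMap 0 R p.2 * Complex.I) := by fun_prop
    exact h4.smul (h3.div h2 fun p => hG p.1 p.1.2 _ (circleMap_mem_sphere c hR p.2))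
  have heq : ((Nat.cast : ℕ → ℝ) ∘ U.domRestrict (fun z =>
      (G.map (Polynomial.evalRingHom z)).roots.countP (dist · c < R)))
      = fun z : U => ((2 * Real.pi * Complex.I)⁻¹ * ∮ x in C(c, R),
      (G.map (Polynomial.evalRingHom (z : ℂ))).derivative.eval x /
        (G.map (Polynomial.evalRingHom (z : ℂ))).eval x).re := by
    funext z
    rw [Polynomial.circleIntegral_logDeriv hR (hG z z.2), ← mul_assoc,
      inv_mul_cancel₀ Complex.two_pi_I_ne_zero, one_mul]
    simp
  rw [heq]
  fun_prop

/-- A function selecting the unique (simple) root in a disc is holomorphic. -/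
lemma Polynomial.differentiableAt_root (G : Polynomial (Polynomial ℂ)) {c : ℂ} {R : ℝ}
    {U : Set ℂ} (hU : IsOpen U) (μ : ℂ → ℂ) (hμ : ∀ z ∈ U, μ z ∈ ball c R)
    (hroot : ∀ z ∈ U, ∀ x ∈ ball c R,
      ((G.map (Polynomial.evalRingHom z)).eval x = 0 ↔ x = μ z))
    {z : ℂ} (hz : z ∈ U)
    (hsimple : (G.map (Polynomial.evalRingHom z)).derivative.eval (μ z) ≠ 0) :
    DifferentiableAt ℂ μ z := by
  set f : ℂ × ℂ → ℂ := fun p => (G.map (Polynomial.evalRingHom p.1)).eval p.2 with hf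
  have hstrict : HasStrictFDerivAt f (fderiv ℂ f (z, μ z)) (z, μ z) :=
    (Polynomial.contDiff_eval_map_eval G).contDiffAt.hasStrictFDerivAt (by norm_num)
  have hpart : HasDerivAt (fun x => f (z, x))
      ((fderiv ℂ f (z, μ z) ∘L ContinuousLinearMap.inr ℂ ℂ ℂ) 1) (μ z) := by
    have h1 : HasDerivAt (fun x : ℂ => (z, x)) ((0 : ℂ), (1 : ℂ)) (μ z) :=
      (hasDerivAt_const _ _).prodMk (hasDerivAt_id _)
    exact hstrict.hasFDerivAt.comp_hasDerivAt (μ z) h1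
  have hpart' : HasDerivAt (fun x => f (z, x))
      ((G.map (Polynomial.evalRingHom z)).derivative.eval (μ z)) (μ z) :=
    (G.map (Polynomial.evalRingHom z)).hasDerivAt (μ z)
  have hval := hpart.unique hpart'
  have hinv : (fderiv ℂ f (z, μ z) ∘L ContinuousLinearMap.inr ℂ ℂ ℂ).IsInvertible := by
    set a := (G.map (Polynomial.evalRingHom z)).derivative.eval (μ z) with ha
    refine ⟨ContinuousLinearEquiv.unitsEquivAut ℂ (Units.mk0 a hsimple), ?_⟩
    ext
    simpa using hval.symm
  have hfz : f (z, μ z) = 0 := (hroot z hz _ (hμ z hz)).2 rfl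
  have hψd := (hstrict.hasStrictFDerivAt_implicitFunctionOfProdDomain hinv).hasFDerivAt
  have hψt := hstrict.tendsto_implicitFunctionOfProdDomain hinv
  have hψe := hstrict.eventually_apply_implicitFunctionOfProdDomain hinv
  set ψ := hstrict.implicitFunctionOfProdDomain hinv
  refine hψd.differentiableAt.congr_of_eventuallyEq ?_
  filter_upwards [hψe, hU.mem_nhds hz, hψt (isOpen_ball.mem_nhds (hμ z hz))] with w hw hwU hwB
  rw [hfz] at hw
  exact ((hroot w hwU _ hwB).1 hw).symm

end RootCount

section Perturbation

open Metric

variable {n : Type*} [Fintype n] [DecidableEq n]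

/-- The characteristic polynomial of `M + z C`, as a polynomial over `ℂ[z]`. -/
def pencilCharpoly (M C : Matrix n n ℂ) : Polynomial (Polynomial ℂ) :=
  (M.map Polynomial.C + (Polynomial.X : Polynomial ℂ) • C.map Polynomial.C).charpoly

lemma pencilCharpoly_map (M C : Matrix n n ℂ) (z : ℂ) :
    (pencilCharpoly M C).map (Polynomial.evalRingHom z) = (M + z • C).charpoly := by
  rw [pencilCharpoly, ← Matrix.charpoly_map]
  congr 1
  ext i j
  simp [mul_comm z]

lemma DifferentiableOn.matrix_det {Z : ℂ → Matrix n n ℂ} {U : Set ℂ}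
    (h : ∀ i j, DifferentiableOn ℂ (fun z => Z z i j) U) :
    DifferentiableOn ℂ (fun z => (Z z).det) U := by
  simp only [Matrix.det_apply]
  refine DifferentiableOn.fun_sum fun σ _ => DifferentiableOn.const_smul ?_ _
  exact DifferentiableOn.fun_finsetProd fun i _ => h _ _

lemma DifferentiableOn.matrix_adjugate {Z : ℂ → Matrix n n ℂ} {U : Set ℂ}
    (h : ∀ i j, DifferentiableOn ℂ (fun z => Z z i j) U) (a b : n) :
    DifferentiableOn ℂ (fun z => (Z z).adjugate a b) U := by
  simp only [Matrix.adjugate_apply]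
  apply DifferentiableOn.matrix_det
  intro i j
  simp only [Matrix.updateRow_apply]
  split_ifs
  · exact differentiableOn_const _
  · exact h i j

/-- The eigenprojection along a holomorphic branch of simple eigenvalues of `M + z C` is
holomorphic. -/
lemma differentiableOn_adjugateProj {M C : Matrix n n ℂ} {μ : ℂ → ℂ} {U : Set ℂ}
    (hμ : DifferentiableOn ℂ μ U) (hs : ∀ z ∈ U, IsSimpleEigenvalue (M + z • C) (μ z)) (a b : n) :
    DifferentiableOn ℂ (fun z => adjugateProj (M + z • C) (μ z) a b) U := by
  have h1 : DifferentiableOn ℂ (fun z => (M + z • C).charpoly.derivative.eval (μ z)) U := by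
    have h2 := (Polynomial.contDiff_eval_map_eval
      (pencilCharpoly M C).derivative).differentiable (by norm_num)
    have h3 : DifferentiableOn ℂ (fun z => (z, μ z)) U := differentiableOn_id.prodMk hμ
    have h4 := h2.comp_differentiableOn h3
    simpa only [Function.comp_def, ← Polynomial.derivative_map, pencilCharpoly_map] using h4
  simp only [adjugateProj, Matrix.smul_apply, smul_eq_mul]
  refine (h1.inv fun z hz => (hs z hz).derivative_ne_zero).mul ?_
  apply DifferentiableOn.matrix_adjugate
  intro i j
  by_cases hij : i = j
  · subst hij
    simp only [Matrix.sub_apply, Matrix.scalar_apply, Matrix.diagonal_apply_eq, Matrix.add_apply,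
      Matrix.smul_apply, smul_eq_mul]
    fun_prop
  · simp only [Matrix.sub_apply, Matrix.scalar_apply, Matrix.diagonal_apply_ne _ hij,
      Matrix.add_apply, Matrix.smul_apply, smul_eq_mul]
    fun_prop

/-- Perturbation of an isolated simple eigenvalue `b` of a Hermitian matrix `M`: if `d` is a
lower bound for the distance of `b` from the other eigenvalues, then `M + z C` has exactly one
eigenvalue in the disc of radius `d / 2` about `b`, for `‖z‖ ‖C‖ < d / 2`, and it depends
holomorphically on `z`. -/
theorem Matrix.IsHermitian.exists_holomorphic_eigenvalue {M : Matrix n n ℂ} (hM : M.IsHermitian)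
    {C : Matrix n n ℂ} {ω d r : ℝ} (hω : 0 < ω)
    (hC : ∀ v : n → ℂ, ‖WithLp.toLp 2 (C *ᵥ v)‖ ≤ ω * ‖WithLp.toLp 2 v‖) (hr : 0 < r)
    (hrd : r * ω ≤ d / 2) (k : n)
    (hsep : ∀ i, i ≠ k → d ≤ |hM.eigenvalues i - hM.eigenvalues k|) :
    ∃ μ : ℂ → ℂ, DifferentiableOn ℂ μ (ball 0 r) ∧ ∀ z ∈ ball (0 : ℂ) r,
      IsSimpleEigenvalue (M + z • C) (μ z) ∧ ‖μ z - hM.eigenvalues k‖ ≤ ‖z‖ * ω ∧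
      ∀ x, (M + z • C).charpoly.IsRoot x → ‖x - hM.eigenvalues k‖ < d / 2 → x = μ z := by
  set c : ℂ := (hM.eigenvalues k : ℂ) with hc
  have hd : 0 < d / 2 := (mul_pos hr hω).trans_le hrd
  have hU : ∀ z ∈ ball (0 : ℂ) r, ‖z‖ * ω < d / 2 := by
    intro z hz
    rw [mem_ball_zero_iff] at hz
    exact (mul_lt_mul_of_pos_right hz hω).trans_le hrd
  have hfar : ∀ i, i ≠ k → d ≤ ‖(hM.eigenvalues i : ℂ) - c‖ := by
    intro i hi
    rw [hc, ← Complex.ofReal_sub, Complex.norm_real, Real.norm_eq_abs]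
    exact hsep i hi
  have hnear : ∀ z ∈ ball (0 : ℂ) r, ∀ x, (M + z • C).charpoly.IsRoot x → ‖x - c‖ ≤ d / 2 →
      ‖x - c‖ ≤ ‖z‖ * ω := by
    intro z hz x hx hxc
    obtain ⟨i, hi⟩ := hM.exists_eigenvalue_near hC hx
    by_cases hik : i = k
    · subst hik; exact hi
    · exfalso
      have h1 := hfar i hik
      have h2 : ‖(hM.eigenvalues i : ℂ) - c‖ ≤ ‖(hM.eigenvalues i : ℂ) - x‖ + ‖x - c‖ :=
        norm_sub_le_norm_sub_add_norm_sub _ _ _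
      rw [norm_sub_rev _ x] at h2
      have := hU z hz
      linarith
  have hcount : ∀ z ∈ ball (0 : ℂ) r,
      (M + z • C).charpoly.roots.countP (dist · c < d / 2) = 1 := by
    intro z hz
    rw [← pencilCharpoly_map, Polynomial.countP_roots_const (pencilCharpoly M C) hd.le
      (convex_ball (0 : ℂ) r).isPreconnected ?_ hz (mem_ball_self hr), pencilCharpoly_map,
      zero_smul, add_zero, hM.roots_charpoly_eq_eigenvalues, Multiset.countP_map]
    · rw [← Finset.filter_val, Finset.card_val, Finset.card_eq_one]
      refine ⟨k, ?_⟩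
      ext i
      simp only [Finset.mem_filter, Finset.mem_univ, true_and, Finset.mem_singleton,
        Function.comp]
      constructor
      · intro h
        by_contra hik
        have := hfar i hik
        rw [dist_eq_norm] at h
        have h' : ‖(hM.eigenvalues i : ℂ) - c‖ < d / 2 := h
        linarith
      · rintro rfl
        rw [dist_eq_norm]
        change ‖(hM.eigenvalues i : ℂ) - c‖ < d / 2
        rw [sub_self, norm_zero]
        exact hd
    · intro w hw x hx h0
      rw [pencilCharpoly_map] at h0
      rw [mem_sphere, dist_eq_norm] at hx
      have := hnear w hw x h0 hx.le
      have := hU w hw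
      linarith
  have hex : ∀ z, ∃ m, z ∈ ball (0 : ℂ) r →
      (M + z • C).charpoly.roots.filter (dist · c < d / 2) = {m} := by
    intro z
    by_cases hz : z ∈ ball (0 : ℂ) r
    · have h := hcount z hz
      rw [Multiset.countP_eq_card_filter, Multiset.card_eq_one] at h
      obtain ⟨m, hm⟩ := h
      exact ⟨m, fun _ => hm⟩
    · exact ⟨0, fun h => absurd h hz⟩
  choose μ hμ using hex
  have hmem : ∀ z ∈ ball (0 : ℂ) r, ∀ x,
      ((M + z • C).charpoly.IsRoot x ∧ dist x c < d / 2) ↔ x = μ z := by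
    intro z hz x
    rw [← Multiset.mem_singleton, ← hμ z hz, Multiset.mem_filter,
      Polynomial.mem_roots (M + z • C).charpoly_monic.ne_zero]
  have hsimple : ∀ z ∈ ball (0 : ℂ) r, IsSimpleEigenvalue (M + z • C) (μ z) := by
    intro z hz
    rw [isSimpleEigenvalue_iff_count]
    have h1 := ((hmem z hz (μ z)).2 rfl).2
    have h2 := Multiset.count_filter_of_pos (p := (dist · c < d / 2))
      (s := (M + z • C).charpoly.roots) h1
    rw [← h2, hμ z hz, Multiset.count_singleton_self]
  refine ⟨μ, ?_, fun z hz => ⟨hsimple z hz, ?_, ?_⟩⟩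
  · intro z hz
    apply DifferentiableAt.differentiableWithinAt
    refine Polynomial.differentiableAt_root (pencilCharpoly M C) (c := c) (R := d / 2)
      (U := ball 0 r) isOpen_ball μ (fun w hw => ((hmem w hw _).2 rfl).2) ?_ hz ?_
    · intro w hw x hx
      rw [pencilCharpoly_map, ← hmem w hw x]
      exact ⟨fun h => ⟨h, hx⟩, fun h => h.1⟩
    · rw [pencilCharpoly_map]
      exact (hsimple z hz).derivative_ne_zero
  · obtain ⟨h1, h2⟩ := (hmem z hz (μ z)).2 rfl
    rw [dist_eq_norm] at h2
    exact hnear z hz _ h1 h2.le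
  · intro x hx hxc
    rw [← dist_eq_norm] at hxc
    exact (hmem z hz x).1 ⟨hx, hxc⟩

end Perturbation

section RankOfReal

variable {n : Type*} [Fintype n] [DecidableEq n]

lemma Matrix.IsHermitian.rank_eq_countP_roots {𝕜 : Type*} [RCLike 𝕜] [DecidableEq 𝕜]
    {M : Matrix n n 𝕜} (hM : M.IsHermitian) :
    M.rank = M.charpoly.roots.countP (· ≠ 0) := by
  rw [hM.rank_eq_card_non_zero_eigs, hM.roots_charpoly_eq_eigenvalues, Multiset.countP_map,
    ← Finset.filter_val, Finset.card_val, Fintype.card_subtype]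
  congr 1
  ext i
  simp

/-- The rank of a real symmetric matrix does not change under complexification. -/
lemma Matrix.IsHermitian.rank_map_ofReal {X : Matrix n n ℝ} (hX : X.IsHermitian) :
    (X.map Complex.ofReal).rank = X.rank := by
  have hX' : (X.map Complex.ofReal).IsHermitian := by
    ext i j
    simpa using congrArg Complex.ofReal (hX.apply i j)
  have hroots : (X.map Complex.ofReal).charpoly.roots = X.charpoly.roots.map Complex.ofReal := by
    have h := Matrix.charpoly_map X Complex.ofRealHom
    have h' : (X.map Complex.ofReal).charpoly = X.charpoly.map Complex.ofRealHom := h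
    rw [h', hX.splits_charpoly.roots_map]
    rfl
  rw [hX.rank_eq_countP_roots, hX'.rank_eq_countP_roots, hroots, Multiset.countP_map,
    Multiset.countP_eq_card_filter]
  congr 1
  apply Multiset.filter_congr
  intro x _
  simp

lemma Matrix.rank_fromBlocks_zero {m : Type*} [Fintype m] [DecidableEq m] (X : Matrix n n ℂ) :
    (Matrix.fromBlocks X 0 0 (0 : Matrix m m ℂ)).rank = X.rank := by
  apply le_antisymm
  · have : Matrix.fromBlocks X 0 0 (0 : Matrix m m ℂ)
        = Matrix.fromRows (1 : Matrix n n ℂ) (0 : Matrix m n ℂ) *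
          (X * Matrix.fromCols (1 : Matrix n n ℂ) (0 : Matrix n m ℂ)) := by
      rw [Matrix.mul_fromCols, Matrix.fromRows_mul_fromCols]
      simp
    rw [this]
    exact (Matrix.rank_mul_le_right _ _).trans (Matrix.rank_mul_le_left _ _)
  · have : X = Matrix.fromCols (1 : Matrix n n ℂ) (0 : Matrix n m ℂ) *
        (Matrix.fromBlocks X 0 0 (0 : Matrix m m ℂ) *
          Matrix.fromRows (1 : Matrix n n ℂ) (0 : Matrix m n ℂ)) := by
      rw [Matrix.fromBlocks_mul_fromRows, Matrix.fromCols_mul_fromRows]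
      simp
    conv_lhs => rw [this]
    exact (Matrix.rank_mul_le_right _ _).trans (Matrix.rank_mul_le_left _ _)

end RankOfReal

/-- Restricting to an invariant subspace containing the range does not change the algebraic
multiplicity of a nonzero eigenvalue. -/
lemma Module.End.rootMultiplicity_restrict_range {V : Type*} [AddCommGroup V] [Module ℂ V]
    [FiniteDimensional ℂ V] (f : Module.End ℂ V) {b : ℂ} (hb : b ≠ 0) :
    (f.restrict (fun x (_ : x ∈ LinearMap.range f) =>
      LinearMap.mem_range_self f x)).charpoly.rootMultiplicity b = f.charpoly.rootMultiplicity b := by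
  rw [← LinearMap.finrank_maxGenEigenspace_eq, ← LinearMap.finrank_maxGenEigenspace_eq]
  have hle : f.maxGenEigenspace b ≤ LinearMap.range f := by
    intro x hx
    rw [Module.End.mem_maxGenEigenspace] at hx
    obtain ⟨k, hk⟩ := hx
    induction k generalizing x with
    | zero => simp at hk; simp [hk]
    | succ k ih =>
      rw [pow_succ, Module.End.mul_apply] at hk
      obtain ⟨y, hy⟩ := ih hk
      refine ⟨b⁻¹ • (x - y), ?_⟩
      rw [map_smul, map_sub, hy]
      simp [hb]
  have h := Module.End.genEigenspace_restrict f (LinearMap.range f) ⊤ b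
    (fun x _ => LinearMap.mem_range_self f x)
  change Module.finrank ℂ ↥(Module.End.genEigenspace _ b ⊤) = _
  rw [h]
  exact (Submodule.comapSubtypeEquivOfLe hle).finrank_eq

namespace LagrangianSystem

variable {N : ℕ} (S : LagrangianSystem N)

lemma pos_dim (S : LagrangianSystem N) : 0 < N := by
  have h := S.R_rank_pos
  have h2 := Matrix.rank_le_card_width S.R
  rw [Fintype.card_fin] at h2
  omega

lemma isHermitian_KpRKp : (S.Kp * S.R * S.Kpᵀ).IsHermitian := by
  have hR : S.Rᵀ = S.R := by
    have := S.R_nonneg.1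
    rwa [Matrix.IsHermitian, Matrix.conjTranspose_eq_transpose_of_trivial] at this
  rw [Matrix.IsHermitian, Matrix.conjTranspose_eq_transpose_of_trivial, Matrix.transpose_mul,
    Matrix.transpose_mul, Matrix.transpose_transpose, hR, Matrix.mul_assoc]

lemma isHermitian_B : S.B.IsHermitian := by
  rw [B]
  apply Matrix.IsHermitian.fromBlocks
  · ext i j
    simpa using congrArg Complex.ofReal (S.isHermitian_KpRKp.apply i j)
  · simp
  · simp [Matrix.IsHermitian]

/-- The real antisymmetric matrix `i Ω`. -/
def reOmega : Matrix (Fin N ⊕ Fin N) (Fin N ⊕ Fin N) ℝ :=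
  Matrix.fromBlocks ((2 : ℝ) • (S.Kp * S.θ * S.Kpᵀ)) S.Phiᵀ (-S.Phi) 0

lemma I_smul_Omega : Complex.I • S.Omega = S.reOmega.map Complex.ofReal := by
  rw [Omega, reOmega, Matrix.fromBlocks_smul, Matrix.fromBlocks_map]
  congr 1
  · ext i j
    simp only [Matrix.smul_apply, Matrix.map_apply, smul_eq_mul, Complex.ofReal_mul]
    push_cast
    linear_combination -2 * ((S.Kp * S.θ * S.Kpᵀ) i j : ℂ) * Complex.I_mul_I
  · ext i j
    simp [← mul_assoc]
  · ext i j
    simp [← mul_assoc]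
  · ext i j
    simp

lemma reOmega_transpose : S.reOmegaᵀ = -S.reOmega := by
  rw [reOmega, Matrix.fromBlocks_transpose, Matrix.fromBlocks_neg]
  congr 1
  · rw [Matrix.transpose_smul, Matrix.transpose_mul, Matrix.transpose_mul,
      Matrix.transpose_transpose, S.θ_skew]
    simp [Matrix.mul_assoc]
  · simp
  · simp

lemma Omega_eq : S.Omega = (-Complex.I) • S.reOmega.map Complex.ofReal := by
  rw [← I_smul_Omega, smul_smul]
  simp

lemma Omega_transpose : S.Omegaᵀ = -S.Omega := by
  rw [Omega_eq, Matrix.transpose_smul, ← Matrix.transpose_map, reOmega_transpose]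
  ext i j
  simp

lemma isHermitian_Omega : S.Omega.IsHermitian := by
  ext i j
  have h := congrFun (congrFun S.reOmega_transpose i) j
  simp only [Matrix.transpose_apply, Matrix.neg_apply] at h
  simp [Omega_eq, h]

lemma abs_eigenvalues_Omega_le (i : Fin N ⊕ Fin N) :
    |S.isHermitian_Omega.eigenvalues i| ≤ S.omegaMax := by
  have hset : ∀ ω : ℝ, (ω : ℂ) ∈ spectrum ℂ S.Omega ↔ ∃ i, S.isHermitian_Omega.eigenvalues i = ω := by
    intro ω
    rw [S.isHermitian_Omega.spectrum_eq_image_range]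
    simp
  have hbdd : BddAbove {ω : ℝ | (ω : ℂ) ∈ spectrum ℂ S.Omega} := by
    apply Set.Finite.bddAbove
    apply (Set.finite_range S.isHermitian_Omega.eigenvalues).subset
    intro ω hω
    exact (hset ω).1 hω
  have hmem := (hset _).2 ⟨i, rfl⟩
  rw [abs_le']
  refine ⟨le_csSup hbdd hmem, le_csSup hbdd ?_⟩
  rw [Set.mem_ofPred_eq]
  rw [Matrix.mem_spectrum_iff_isRoot_charpoly, Polynomial.IsRoot, Matrix.eval_charpoly] at hmem ⊢
  rw [← Matrix.det_transpose, Matrix.transpose_sub, Omega_transpose, Matrix.scalar_apply,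
    Matrix.diagonal_transpose] at hmem
  rw [Complex.ofReal_neg, Matrix.scalar_apply]
  have h1 : (Matrix.diagonal fun _ : Fin N ⊕ Fin N =>
      (-(S.isHermitian_Omega.eigenvalues i : ℂ))) - S.Omega
      = -((Matrix.diagonal fun _ => (S.isHermitian_Omega.eigenvalues i : ℂ)) - -S.Omega) := by
    ext a b
    by_cases hab : a = b
    · subst hab; simp; ring
    · simp [hab]
  rw [h1, Matrix.det_neg, hmem, mul_zero]

lemma omegaMax_nonneg : 0 ≤ S.omegaMax :=
  (abs_nonneg _).trans (S.abs_eigenvalues_Omega_le (Sum.inl ⟨0, S.pos_dim⟩))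

lemma norm_I_smul_Omega_mulVec_le (v : Fin N ⊕ Fin N → ℂ) :
    ‖WithLp.toLp 2 ((Complex.I • S.Omega) *ᵥ v)‖ ≤ S.omegaMax * ‖WithLp.toLp 2 v‖ := by
  rw [Matrix.smul_mulVec, WithLp.toLp_smul, norm_smul, Complex.norm_I, one_mul]
  exact S.isHermitian_Omega.norm_mulVec_le S.omegaMax_nonneg S.abs_eigenvalues_Omega_le v

lemma sqrt_transpose (X : Matrix (Fin N) (Fin N) ℝ) : (CFC.sqrt X)ᵀ = CFC.sqrt X := by
  have h := (Matrix.nonneg_iff_posSemidef.1 (CFC.sqrt_nonneg X)).1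
  rwa [Matrix.IsHermitian, Matrix.conjTranspose_eq_transpose_of_trivial] at h

lemma isUnit_det_sqrt {X : Matrix (Fin N) (Fin N) ℝ} (hX : X.PosDef) :
    IsUnit (CFC.sqrt X).det := by
  have h := CFC.sqrt_mul_sqrt_self X (Matrix.nonneg_iff_posSemidef.2 hX.posSemidef)
  have h2 := congrArg Matrix.det h
  rw [Matrix.det_mul] at h2
  rw [isUnit_iff_ne_zero]
  intro h0
  rw [h0, zero_mul] at h2
  exact hX.det_pos.ne h2

lemma Kp_transpose : S.Kpᵀ = S.Kp := by
  rw [Kp, Matrix.transpose_nonsing_inv, sqrt_transpose]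

lemma isUnit_det_Kp : IsUnit S.Kp.det := by
  rw [Kp, Matrix.det_nonsing_inv]
  exact (isUnit_det_sqrt S.α_pos).ringInverse

lemma rank_B : S.B.rank = S.rankR := by
  have h : IsUnit (S.Kpᵀ).det := by rw [Matrix.det_transpose]; exact S.isUnit_det_Kp
  rw [B, Matrix.rank_fromBlocks_zero, S.isHermitian_KpRKp.rank_map_ofReal,
    Matrix.rank_mul_eq_left_of_isUnit_det _ _ h, Matrix.rank_mul_eq_right_of_isUnit_det _ _
    S.isUnit_det_Kp, rankR]

lemma Phi_mul_Phi_dual (hη : S.η.PosDef) : S.Phi * (S.dual hη).Phi = 1 := by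
  simp only [Phi, Kp_transpose]
  simp only [Kq, Kp, dual]
  rw [Matrix.mul_assoc, ← Matrix.mul_assoc (CFC.sqrt S.α)⁻¹,
    Matrix.nonsing_inv_mul _ (isUnit_det_sqrt S.α_pos), Matrix.one_mul,
    Matrix.mul_nonsing_inv _ (isUnit_det_sqrt hη)]

lemma Kp_dual_mul_Phi (hη : S.η.PosDef) : (S.dual hη).Kp * S.Phi = S.Kp := by
  simp only [Phi, Kp_transpose]
  simp only [Kq, Kp, dual]
  rw [← Matrix.mul_assoc, Matrix.nonsing_inv_mul _ (isUnit_det_sqrt hη), Matrix.one_mul]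

lemma Phi_dual_transpose_mul_Kp (hη : S.η.PosDef) :
    (S.dual hη).Phiᵀ * S.Kp = (S.dual hη).Kp := by
  simp only [Phi, Matrix.transpose_mul, Matrix.transpose_transpose, Kq, sqrt_transpose, Kp, dual]
  rw [Matrix.mul_assoc, Matrix.mul_nonsing_inv _ (isUnit_det_sqrt S.α_pos), Matrix.mul_one]

lemma omegaMax_pos (hη : S.η.PosDef) : 0 < S.omegaMax := by
  refine lt_of_le_of_ne S.omegaMax_nonneg fun h0 => ?_
  have h1 : S.isHermitian_Omega.eigenvalues = 0 := by
    funext i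
    have := S.abs_eigenvalues_Omega_le i
    rw [← h0] at this
    exact abs_nonpos_iff.1 this
  have h2 : S.Omega = 0 := S.isHermitian_Omega.eigenvalues_eq_zero_iff.1 h1
  have h3 : S.Phi = 0 := by
    ext i j
    have := congrFun (congrFun h2 (Sum.inr i)) (Sum.inl j)
    simpa [Omega] using this
  have h4 := S.Phi_mul_Phi_dual hη
  rw [h3, zero_mul] at h4
  have := congrFun (congrFun h4 ⟨0, S.pos_dim⟩) ⟨0, S.pos_dim⟩
  simp at this

lemma map_ofReal_mul (X Y : Matrix (Fin N) (Fin N) ℝ) :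
    (X * Y).map Complex.ofReal = X.map Complex.ofReal * Y.map Complex.ofReal :=
  Matrix.map_mul (f := Complex.ofRealHom)

/-- `A` in terms of the complexified matrices. -/
lemma A_eq (β : ℂ) : S.A β = Matrix.fromBlocks
    ((-Complex.I) • (S.Kp.map Complex.ofReal * ((2 : ℂ) • S.θ.map Complex.ofReal
      + β • S.R.map Complex.ofReal) * S.Kp.map Complex.ofReal))
    ((-Complex.I) • (S.Phi.map Complex.ofReal)ᵀ)
    (Complex.I • S.Phi.map Complex.ofReal) 0 := by
  rw [A, Omega, B, Matrix.fromBlocks_smul, sub_eq_add_neg,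
    Matrix.fromBlocks_neg, Matrix.fromBlocks_add, Kp_transpose, map_ofReal_mul, map_ofReal_mul, map_ofReal_mul,
    map_ofReal_mul]
  congr 1
  · simp only [Matrix.mul_add, Matrix.add_mul, Matrix.mul_smul, Matrix.smul_mul, smul_add,
      smul_smul, ← neg_smul]
    congr 2 <;> ring
  · simp [Matrix.transpose_map]
  · simp
  · simp

/-- `A` of the dual system is `-A⁻¹` with the two blocks interchanged. -/
lemma A_dual_mul (hη : S.η.PosDef) (β : ℂ) :
    (S.dual hη).A β * (S.A β).submatrix Sum.swap Sum.swap = -1 := by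
  have h1 := congrArg (fun X => X.map Complex.ofReal) (S.Phi_mul_Phi_dual hη)
  have h1' := congrArg (fun X => X.map Complex.ofReal)
    (mul_eq_one_comm.1 (S.Phi_mul_Phi_dual hη))
  have h2 := congrArg (fun X => X.map Complex.ofReal) (S.Kp_dual_mul_Phi hη)
  have h3 := congrArg (fun X => X.map Complex.ofReal) (S.Phi_dual_transpose_mul_Kp hη)
  simp only [map_ofReal_mul, Matrix.transpose_map] at h1 h1' h2 h3
  rw [Matrix.map_one _ (by simp) (by simp)] at h1 h1'
  have h1t := congrArg Matrix.transpose h1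
  rw [Matrix.transpose_mul, Matrix.transpose_one] at h1t
  rw [A_eq, A_eq, Matrix.fromBlocks_submatrix_sum_swap_sum_swap,
    Matrix.fromBlocks_multiply]
  have hθ : (S.dual hη).θ = S.θ := rfl
  have hR : (S.dual hη).R = S.R := rfl
  rw [hθ, hR]
  rw [← Matrix.fromBlocks_one, Matrix.fromBlocks_neg]
  simp only [Matrix.mul_zero, Matrix.zero_mul, zero_add, Matrix.smul_mul,
    Matrix.mul_smul, smul_smul, h1t, h1', neg_zero]
  congr 1
  · simp
  · rw [Matrix.mul_assoc, h2, ← Matrix.mul_assoc, ← Matrix.mul_assoc, h3]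
    simp
  · simp
  · simp

open Metric

lemma mem_spectrum_B_iff (b : ℂ) :
    b ∈ spectrum ℂ S.B ↔ ∃ i, (S.isHermitian_B.eigenvalues i : ℂ) = b := by
  rw [S.isHermitian_B.spectrum_eq_image_range, ← Set.range_comp]
  rfl

lemma zero_mem_spectrum_B : (0 : ℂ) ∈ spectrum ℂ S.B := by
  have : Nonempty (Fin N) := ⟨⟨0, S.pos_dim⟩⟩
  rw [Matrix.mem_spectrum_iff_isRoot_charpoly, Polynomial.IsRoot, Matrix.eval_charpoly, map_zero,
    zero_sub, Matrix.det_neg, B, Matrix.det_fromBlocks_zero₂₁, Matrix.det_zero, mul_zero, mul_zero]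

lemma card_eigenvalues_B : Fintype.card {k // S.isHermitian_B.eigenvalues k ≠ 0} = S.rankR := by
  rw [← S.isHermitian_B.rank_eq_card_non_zero_eigs, rank_B]

lemma gap_le {b b' : ℂ} (hb : b ∈ spectrum ℂ S.B) (hb' : b' ∈ spectrum ℂ S.B) (h : b ≠ b') :
    S.gap ≤ ‖b - b'‖ := by
  refine csInf_le ⟨0, ?_⟩ ⟨b, hb, b', hb', h, rfl⟩
  rintro _ ⟨_, _, _, _, _, rfl⟩
  exact norm_nonneg _

lemma gap_pos : 0 < S.gap := by
  have hfin : {x : ℝ | ∃ b ∈ spectrum ℂ S.B, ∃ b' ∈ spectrum ℂ S.B, b ≠ b' ∧ x = ‖b - b'‖}.Finite := by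
    have hs : (spectrum ℂ S.B).Finite := by
      rw [S.isHermitian_B.spectrum_eq_image_range]
      exact (Set.finite_range _).image _
    apply ((hs.prod hs).image (fun p => ‖p.1 - p.2‖)).subset
    rintro _ ⟨b, hb, b', hb', _, rfl⟩
    exact ⟨(b, b'), ⟨hb, hb'⟩, rfl⟩
  have hne : {x : ℝ | ∃ b ∈ spectrum ℂ S.B, ∃ b' ∈ spectrum ℂ S.B,
      b ≠ b' ∧ x = ‖b - b'‖}.Nonempty := by
    have h1 : 0 < Fintype.card {k // S.isHermitian_B.eigenvalues k ≠ 0} := by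
      rw [card_eigenvalues_B]; exact S.R_rank_pos
    obtain ⟨k, hk⟩ := Fintype.card_pos_iff.1 h1
    exact ⟨_, _, (S.mem_spectrum_B_iff _).2 ⟨k, rfl⟩, 0, S.zero_mem_spectrum_B,
      by exact_mod_cast hk, rfl⟩
  obtain ⟨b, _, b', _, hbb, h⟩ := hne.csInf_mem hfin
  rw [gap, h]
  exact norm_pos_iff.2 (sub_ne_zero.2 hbb)

lemma gap_le_abs {k : Fin N ⊕ Fin N} (hk : S.isHermitian_B.eigenvalues k ≠ 0) :
    S.gap ≤ |S.isHermitian_B.eigenvalues k| := by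
  have h := S.gap_le ((S.mem_spectrum_B_iff _).2 ⟨k, rfl⟩) S.zero_mem_spectrum_B
    (by exact_mod_cast hk)
  simpa using h

/-- Under the generic condition a nonzero eigenvalue of `B` is separated by the gap from all other
eigenvalues. -/
lemma Generic.gap_le_abs_sub {S : LagrangianSystem N} (hgen : S.Generic) {k : Fin N ⊕ Fin N}
    (hk : S.isHermitian_B.eigenvalues k ≠ 0) (i : Fin N ⊕ Fin N) (hik : i ≠ k) :
    S.gap ≤ |S.isHermitian_B.eigenvalues i - S.isHermitian_B.eigenvalues k| := by
  have hne : S.isHermitian_B.eigenvalues i ≠ S.isHermitian_B.eigenvalues k := by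
    intro heq
    have h1 : S.B.charpoly.roots.count (S.isHermitian_B.eigenvalues k : ℂ) ≤ 1 := by
      rw [Polynomial.count_roots, ← Matrix.charpoly_toLin',
        ← Module.End.rootMultiplicity_restrict_range (Matrix.toLin' S.B) (by exact_mod_cast hk),
        ← Polynomial.count_roots]
      exact Multiset.nodup_iff_count_le_one.1 hgen _
    rw [S.isHermitian_B.roots_charpoly_eq_eigenvalues, Multiset.count_map, ← Finset.filter_val,
      Finset.card_val, Finset.card_le_one] at h1
    apply hik
    apply h1 <;> simp [heq]
  have h := S.gap_le ((S.mem_spectrum_B_iff _).2 ⟨i, rfl⟩) ((S.mem_spectrum_B_iff _).2 ⟨k, rfl⟩)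
    (by exact_mod_cast hne)
  rwa [← Complex.ofReal_sub, Complex.norm_real] at h

/-- The pencil `B + z i Ω = i z A(z⁻¹)`. -/
def pencil (z : ℂ) : Matrix (Fin N ⊕ Fin N) (Fin N ⊕ Fin N) ℂ := S.B + z • (Complex.I • S.Omega)

lemma A_inv_eq_smul_pencil {z : ℂ} (hz : z ≠ 0) : S.A z⁻¹ = (-Complex.I * z⁻¹) • S.pencil z := by
  rw [A, pencil, smul_add, smul_smul, smul_smul]
  have h1 : -Complex.I * z⁻¹ * (z * Complex.I) = 1 := by
    have := Complex.I_mul_I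
    field_simp
    linear_combination -this
  rw [mul_assoc, mul_assoc, ← mul_assoc (-Complex.I), h1]
  module

lemma isRoot_conj_of_pencil (t : ℝ) {x : ℂ} (hx : (S.pencil t).charpoly.IsRoot x) :
    (S.pencil t).charpoly.IsRoot (starRingEnd ℂ x) := by
  have hreal : S.pencil t = ((Matrix.fromBlocks (S.Kp * S.R * S.Kpᵀ) 0 0 0 + t • S.reOmega :
      Matrix (Fin N ⊕ Fin N) (Fin N ⊕ Fin N) ℝ)).map Complex.ofRealHom := by
    rw [pencil, I_smul_Omega, B, Matrix.map_add _ (map_add _)]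
    rw [Matrix.fromBlocks_map]
    congr 1
    · simp
      ext i j
      simp
  rw [hreal, Matrix.charpoly_map] at hx ⊢
  rw [Polynomial.IsRoot, Polynomial.eval_map] at hx ⊢
  have h := congrArg (starRingEnd ℂ) hx
  rw [Polynomial.hom_eval₂, map_zero] at h
  have hc : (starRingEnd ℂ).comp Complex.ofRealHom = Complex.ofRealHom := by
    ext r; simp
  rwa [hc] at h

/-- The eigenvalues of the pencil that do not vanish at `z = 0`. -/
lemma exists_pencil_eigenvalues (hω : 0 < S.omegaMax) (hgen : S.Generic) :
    ∃ μ : Fin S.rankR → ℂ → ℂ,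
      (∀ j, DifferentiableOn ℂ (μ j) (ball 0 S.beta0⁻¹)) ∧
      (∀ j, ∀ z ∈ ball (0 : ℂ) S.beta0⁻¹, IsSimpleEigenvalue (S.pencil z) (μ j z)) ∧
      (∀ z ∈ ball (0 : ℂ) S.beta0⁻¹, Function.Injective (fun j => μ j z)) ∧
      (∀ j, ∀ z ∈ ball (0 : ℂ) S.beta0⁻¹, ‖z‖ * S.omegaMax < ‖μ j z‖ ∧ S.gap / 2 < ‖μ j z‖) ∧
      (∀ z ∈ ball (0 : ℂ) S.beta0⁻¹, ∀ x, (S.pencil z).charpoly.IsRoot x →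
        ‖z‖ * S.omegaMax < ‖x‖ → ∃ j, x = μ j z) ∧
      (∀ j, ∀ t : ℝ, (t : ℂ) ∈ ball (0 : ℂ) S.beta0⁻¹ → (μ j t).im = 0) := by
  have hd := S.gap_pos
  have hr : 0 < S.beta0⁻¹ := inv_pos.2 (by rw [beta0]; positivity)
  have hrd : S.beta0⁻¹ * S.omegaMax ≤ S.gap / 2 := by
    rw [beta0]
    field_simp
    exact le_refl _
  have hU : ∀ z ∈ ball (0 : ℂ) S.beta0⁻¹, ‖z‖ * S.omegaMax < S.gap / 2 := by
    intro z hz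
    rw [mem_ball_zero_iff] at hz
    exact (mul_lt_mul_of_pos_right hz hω).trans_le hrd
  have hex := fun k : {k // S.isHermitian_B.eigenvalues k ≠ 0} =>
    S.isHermitian_B.exists_holomorphic_eigenvalue hω S.norm_I_smul_Omega_mulVec_le hr hrd k
      (hgen.gap_le_abs_sub k.2)
  choose ν hνd hν using hex
  let e : Fin S.rankR ≃ {k // S.isHermitian_B.eigenvalues k ≠ 0} :=
    (Fintype.equivFinOfCardEq S.card_eigenvalues_B).symm
  refine ⟨fun j => ν (e j), fun j => hνd _, fun j z hz => (hν (e j) z hz).1, ?_, ?_, ?_, ?_⟩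
  · intro z hz j k hjk
    by_contra hne
    have h1 := (hν (e j) z hz).2.1
    have h2 := (hν (e k) z hz).2.1
    have h3 := hgen.gap_le_abs_sub (e k).2 (e j) (fun h => hne (e.injective (Subtype.ext h)))
    have h4 := hU z hz
    simp only at hjk
    rw [hjk] at h1
    rw [← Real.norm_eq_abs, ← Complex.norm_real, Complex.ofReal_sub] at h3
    have h5 := norm_sub_le_norm_sub_add_norm_sub
      (S.isHermitian_B.eigenvalues (e j) : ℂ) (ν (e k) z) (S.isHermitian_B.eigenvalues (e k))
    rw [norm_sub_rev _ (ν (e k) z)] at h5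
    linarith
  · intro j z hz
    have h1 := (hν (e j) z hz).2.1
    have h2 := hU z hz
    have h3 := S.gap_le_abs (e j).2
    rw [← Real.norm_eq_abs, ← Complex.norm_real] at h3
    have h4 := norm_sub_norm_le (S.isHermitian_B.eigenvalues (e j) : ℂ) (ν (e j) z)
    rw [norm_sub_rev] at h4
    constructor <;> linarith
  · intro z hz x hx hxz
    obtain ⟨i, hi⟩ := S.isHermitian_B.exists_eigenvalue_near S.norm_I_smul_Omega_mulVec_le hx
    have hi0 : S.isHermitian_B.eigenvalues i ≠ 0 := by
      intro h0
      rw [h0, Complex.ofReal_zero, sub_zero] at hi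
      linarith
    refine ⟨e.symm ⟨i, hi0⟩, ?_⟩
    simp only [Equiv.apply_symm_apply]
    exact (hν ⟨i, hi0⟩ z hz).2.2 x hx (hi.trans_lt (hU z hz))
  · intro j t ht
    have h := hν (e j) t ht
    rw [← Complex.conj_eq_iff_im]
    refine h.2.2 _ (S.isRoot_conj_of_pencil t h.1.isRoot) ?_
    have h1 := Complex.norm_conj (ν (e j) t - S.isHermitian_B.eigenvalues (e j))
    rw [map_sub, Complex.conj_ofReal] at h1
    rw [h1]
    exact h.2.1.trans_lt (hU t ht)

lemma norm_neg_I_mul (x : ℂ) : ‖-Complex.I * x‖ = ‖x‖ := by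
  rw [norm_mul, norm_neg, Complex.norm_I, one_mul]

/-- The high-loss eigenvalues of `A(z⁻¹)` are `-i z⁻¹ μ_j(z)`. -/
lemma roots_filter_A {μ : Fin S.rankR → ℂ → ℂ} {z : ℂ} (hz : z ≠ 0)
    (hs : ∀ j, IsSimpleEigenvalue (S.pencil z) (μ j z))
    (hinj : Function.Injective (fun j => μ j z))
    (hlt : ∀ j, ‖z‖ * S.omegaMax < ‖μ j z‖)
    (hall : ∀ x, (S.pencil z).charpoly.IsRoot x → ‖z‖ * S.omegaMax < ‖x‖ → ∃ j, x = μ j z) :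
    (S.A z⁻¹).charpoly.roots.filter (fun x => S.omegaMax < ‖x‖)
      = Finset.univ.val.map (fun j => -Complex.I * z⁻¹ * μ j z) := by
  have hz' : 0 < ‖z‖ := norm_pos_iff.2 hz
  have hc : -Complex.I * z⁻¹ ≠ 0 := mul_ne_zero (neg_ne_zero.2 Complex.I_ne_zero) (inv_ne_zero hz)
  rw [S.A_inv_eq_smul_pencil hz, Matrix.roots_charpoly_smul _ hc, Multiset.filter_map]
  have h1 : (S.pencil z).charpoly.roots.filter ((fun x => S.omegaMax < ‖x‖) ∘
      (fun r => -Complex.I * z⁻¹ * r)) = Finset.univ.val.map (fun j => μ j z) := by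
    have hp : ∀ x : ℂ, S.omegaMax < ‖-Complex.I * z⁻¹ * x‖ ↔ ‖z‖ * S.omegaMax < ‖x‖ := by
      intro x
      rw [mul_assoc, norm_neg_I_mul, norm_mul, norm_inv, ← div_eq_inv_mul, lt_div_iff₀' hz']
    have hmem : ∀ x, x ∈ (S.pencil z).charpoly.roots.filter ((fun x => S.omegaMax < ‖x‖) ∘
        (fun r => -Complex.I * z⁻¹ * r)) ↔ x ∈ Finset.univ.val.map (fun j => μ j z) := by
      intro x
      rw [Multiset.mem_filter, Polynomial.mem_roots (S.pencil z).charpoly_monic.ne_zero,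
        Function.comp, hp]
      simp only [Multiset.mem_map, Finset.mem_val, Finset.mem_univ, true_and]
      constructor
      · rintro ⟨h, h'⟩
        obtain ⟨j, hj⟩ := hall x h h'
        exact ⟨j, hj.symm⟩
      · rintro ⟨j, rfl⟩
        exact ⟨(hs j).isRoot, hlt j⟩
    refine (Multiset.Nodup.ext ?_ (Finset.univ.nodup.map hinj)).2 hmem
    rw [Multiset.nodup_iff_count_le_one]
    intro x
    by_cases hx : x ∈ Finset.univ.val.map (fun j => μ j z)
    · obtain ⟨j, _, rfl⟩ := Multiset.mem_map.1 hx
      exact (Multiset.count_le_of_le _ (Multiset.filter_le _ _)).trans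
        (isSimpleEigenvalue_iff_count.1 (hs j)).le
    · rw [← hmem] at hx
      rw [Multiset.count_eq_zero_of_notMem hx]
      exact zero_le_one
  rw [h1, Multiset.map_map]
  rfl

/-- Simple eigenvalues of the pencil give simple eigenvalues of `A(z⁻¹)`. -/
lemma isSimpleEigenvalue_A {z x : ℂ} (hz : z ≠ 0) (hs : IsSimpleEigenvalue (S.pencil z) x) :
    IsSimpleEigenvalue (S.A z⁻¹) (-Complex.I * z⁻¹ * x) := by
  have hc : -Complex.I * z⁻¹ ≠ 0 := mul_ne_zero (neg_ne_zero.2 Complex.I_ne_zero) (inv_ne_zero hz)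
  rw [isSimpleEigenvalue_iff_count] at hs ⊢
  rw [S.A_inv_eq_smul_pencil hz, Matrix.roots_charpoly_smul _ hc,
    Multiset.count_map_eq_count' _ _ (mul_right_injective₀ hc), hs]

lemma isEigenprojection_A {z x : ℂ} (hz : z ≠ 0) (hs : IsSimpleEigenvalue (S.pencil z) x) :
    IsEigenprojection (S.A z⁻¹) (-Complex.I * z⁻¹ * x) (adjugateProj (S.pencil z) x) := by
  refine (S.isSimpleEigenvalue_A hz hs).isEigenprojection (adjugateProj_ne_zero hs)
    (adjugateProj_mul_self hs) ?_ ?_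
  · rw [S.A_inv_eq_smul_pencil hz, Matrix.smul_mul, mul_adjugateProj hs, smul_smul]
  · rw [S.A_inv_eq_smul_pencil hz, Matrix.mul_smul, adjugateProj_mul hs, smul_smul]

lemma inv_mem_ball {b β : ℝ} (hb : 0 < b) (hβ : b < β) :
    ((β : ℂ)⁻¹) ∈ ball (0 : ℂ) b⁻¹ \ {0} := by
  have hβ0 := hb.trans hβ
  refine ⟨?_, ?_⟩
  · rw [mem_ball_zero_iff, norm_inv, Complex.norm_real, Real.norm_eq_abs, abs_of_pos hβ0]
    exact inv_strictAnti₀ hb hβ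
  · rw [Set.mem_singleton_iff, inv_eq_zero]
    exact_mod_cast hβ0.ne'

/-- Interchange of the two blocks. -/
abbrev swapBlocks (M : Matrix (Fin N ⊕ Fin N) (Fin N ⊕ Fin N) ℂ) :
    Matrix (Fin N ⊕ Fin N) (Fin N ⊕ Fin N) ℂ :=
  Matrix.reindex (Equiv.sumComm _ _) (Equiv.sumComm _ _) M

lemma swapBlocks_mul (X Y : Matrix (Fin N ⊕ Fin N) (Fin N ⊕ Fin N) ℂ) :
    swapBlocks (X * Y) = swapBlocks X * swapBlocks Y :=
  map_mul (Matrix.reindexAlgEquiv ℂ ℂ (Equiv.sumComm (Fin N) (Fin N))) X Y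

lemma A_mul_swapBlocks (hη : S.η.PosDef) (β : ℂ) :
    S.A β * swapBlocks ((S.dual hη).A β) = -1 := by
  have h := congrArg swapBlocks (S.A_dual_mul hη β)
  rw [swapBlocks_mul] at h
  have h1 : swapBlocks ((S.A β).submatrix Sum.swap Sum.swap) = S.A β := by
    ext i j
    simp
  have h2 : swapBlocks (-1 : Matrix (Fin N ⊕ Fin N) (Fin N ⊕ Fin N) ℂ) = -1 := by
    rw [swapBlocks, Matrix.reindex_apply, Matrix.submatrix_neg, Pi.neg_apply, Pi.neg_apply,
      Matrix.submatrix_one_equiv]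
  rw [h1, h2, eq_neg_iff_add_eq_zero, add_comm, ← eq_neg_iff_add_eq_zero, ← Matrix.neg_mul,
    eq_comm, mul_eq_one_comm, Matrix.mul_neg, neg_eq_iff_eq_neg] at h
  exact h

/-- The eigenvalues of `A(β)` are the `-1/r`, for `r` the eigenvalues for the dual system. -/
lemma roots_charpoly_A_eq_dual (hη : S.η.PosDef) (β : ℂ) :
    (S.A β).charpoly.roots = ((S.dual hη).A β).charpoly.roots.map (fun r => -r⁻¹) := by
  rw [Matrix.roots_charpoly_of_mul_eq_neg_one (S.A_mul_swapBlocks hη β), Matrix.charpoly_reindex]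

lemma neg_inv_injective : Function.Injective (fun r : ℂ => -r⁻¹) :=
  neg_injective.comp inv_injective

lemma isSimpleEigenvalue_of_dual (hη : S.η.PosDef) {β x : ℂ}
    (h : IsSimpleEigenvalue ((S.dual hη).A β) x) : IsSimpleEigenvalue (S.A β) (-x⁻¹) := by
  rw [isSimpleEigenvalue_iff_count] at h ⊢
  rw [S.roots_charpoly_A_eq_dual hη]
  exact (Multiset.count_map_eq_count' _ _ neg_inv_injective _).trans h

lemma isEigenprojection_of_dual (hη : S.η.PosDef) {β x : ℂ} (hx : x ≠ 0)
    {P : Matrix (Fin N ⊕ Fin N) (Fin N ⊕ Fin N) ℂ} (h : IsSimpleEigenvalue ((S.dual hη).A β) x)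
    (hP : P ≠ 0) (hPP : P * P = P) (hMP : (S.dual hη).A β * P = x • P)
    (hPM : P * (S.dual hη).A β = x • P) : IsEigenprojection (S.A β) (-x⁻¹) (swapBlocks P) := by
  have h1 := S.A_mul_swapBlocks hη β
  have h2 : swapBlocks ((S.dual hη).A β) * S.A β = -1 := by
    rw [eq_neg_iff_add_eq_zero, add_comm, ← eq_neg_iff_add_eq_zero, ← Matrix.mul_neg, eq_comm,
      mul_eq_one_comm, Matrix.neg_mul, h1, neg_neg]
  have h3 : swapBlocks (x • P) = x • swapBlocks P := rfl
  refine (S.isSimpleEigenvalue_of_dual hη h).isEigenprojection ?_ ?_ ?_ ?_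
  · exact (Matrix.reindex _ _).injective.ne hP
  · rw [← swapBlocks_mul, hPP]
  · have h4 := congrArg swapBlocks hMP
    rw [swapBlocks_mul, h3] at h4
    have h5 := congrArg (fun Z => S.A β * Z) h4
    simp only [← Matrix.mul_assoc, h1, Matrix.mul_smul] at h5
    rw [neg_smul, eq_neg_iff_add_eq_zero, ← smul_right_injective _ hx |>.eq_iff]
    simp only [smul_add, smul_zero]
    rw [← h5, smul_inv_smul₀ hx]
    simp
  · have h4 := congrArg swapBlocks hPM
    rw [swapBlocks_mul, h3] at h4
    have h5 := congrArg (fun Z => Z * S.A β) h4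
    simp only [Matrix.mul_assoc, h2, Matrix.smul_mul] at h5
    rw [neg_smul, eq_neg_iff_add_eq_zero, ← smul_right_injective _ hx |>.eq_iff]
    simp only [smul_add, smul_zero]
    rw [← h5, smul_inv_smul₀ hx]
    simp

lemma beta0_pos (hω : 0 < S.omegaMax) : 0 < S.beta0 := by
  have := S.gap_pos
  rw [beta0]
  positivity

lemma tendsto_ofReal_inv : Tendsto (fun β : ℝ => (β : ℂ)⁻¹) atTop (𝓝 0) := by
  have h := (Complex.continuous_ofReal.tendsto 0).comp tendsto_inv_atTop_zero
  simpa [Function.comp_def] using h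

theorem exists_highLoss (hη : S.η.PosDef) (hgen : S.Generic) :
    ∃ (ζ : Fin S.rankR → ℂ → ℂ)
        (P : Fin S.rankR → ℂ → Matrix (Fin N ⊕ Fin N) (Fin N ⊕ Fin N) ℂ),
      S.IsHighLossFamily ζ ∧
      (∀ j, MeromorphicAt (ζ j) 0 ∧
        AnalyticOnNhd ℂ (ζ j) (Metric.ball 0 (S.beta0)⁻¹ \ {0})) ∧
      (∀ j, (∀ a b, AnalyticOnNhd ℂ (fun z => P j z a b) (Metric.ball 0 (S.beta0)⁻¹)) ∧
        ∀ z ∈ Metric.ball (0 : ℂ) (S.beta0)⁻¹, (P j z).rank = 1) ∧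
      (∀ j, ∀ z ∈ Metric.ball (0 : ℂ) (S.beta0)⁻¹ \ {0},
        IsSimpleEigenvalue (S.A z⁻¹) (ζ j z) ∧ IsEigenprojection (S.A z⁻¹) (ζ j z) (P j z)) ∧
      (∀ j, ∀ β : ℝ, S.beta0 < β → (ζ j ((β : ℂ)⁻¹)).re = 0) := by
  have hω := S.omegaMax_pos hη
  have hβ0 := S.beta0_pos hω
  obtain ⟨μ, hd, hs, hinj, hlt, hall, hre⟩ := S.exists_pencil_eigenvalues hω hgen
  have han : ∀ j, AnalyticOnNhd ℂ (μ j) (ball 0 S.beta0⁻¹) :=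
    fun j => (hd j).analyticOnNhd isOpen_ball
  have h0 : (0 : ℂ) ∈ ball (0 : ℂ) S.beta0⁻¹ := mem_ball_self (inv_pos.2 hβ0)
  refine ⟨fun j z => -Complex.I * z⁻¹ * μ j z, fun j z => adjugateProj (S.pencil z) (μ j z),
    ⟨?_, S.omegaMax, ?_⟩, ?_, ?_, ?_, ?_⟩
  · intro j
    refine tendsto_atTop_mono' _ ?_
      (tendsto_id.atTop_mul_const (show 0 < S.gap / 2 from half_pos S.gap_pos))
    filter_upwards [eventually_gt_atTop S.beta0] with β hβ
    have hz := inv_mem_ball hβ0 hβ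
    rw [inv_inv, mul_assoc, norm_neg_I_mul, norm_mul, Complex.norm_real, Real.norm_eq_abs,
      abs_of_pos (hβ0.trans hβ)]
    exact mul_le_mul_of_nonneg_left (hlt j _ hz.1).2.le (hβ0.trans hβ).le
  · filter_upwards [eventually_gt_atTop S.beta0] with β hβ
    have hz := inv_mem_ball hβ0 hβ
    have h := S.roots_filter_A hz.2 (fun j => hs j _ hz.1) (hinj _ hz.1)
      (fun j => (hlt j _ hz.1).1) (hall _ hz.1)
    rw [inv_inv] at h
    simp only [inv_inv]
    exact h
  · intro j
    refine ⟨((MeromorphicAt.const _ _).mul (MeromorphicAt.id _).inv).mul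
      (han j 0 h0).meromorphicAt, ?_⟩
    intro z hz
    exact (analyticAt_const.mul (analyticAt_id.inv hz.2)).mul (han j z hz.1)
  · intro j
    refine ⟨fun a b => ?_, fun z hz => rank_adjugateProj (hs j z hz)⟩
    exact (differentiableOn_adjugateProj (hd j) (hs j) a b).analyticOnNhd isOpen_ball
  · intro j z hz
    exact ⟨S.isSimpleEigenvalue_A hz.2 (hs j z hz.1), S.isEigenprojection_A hz.2 (hs j z hz.1)⟩
  · intro j β hβ
    have hz := inv_mem_ball hβ0 hβ
    have him := hre j β⁻¹ (by rw [Complex.ofReal_inv]; exact hz.1)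
    rw [Complex.ofReal_inv] at him
    simp [Complex.mul_re, him]

lemma neg_inv_neg_I_mul (z x : ℂ) : -(-Complex.I * z⁻¹ * x)⁻¹ = -Complex.I * z * x⁻¹ := by
  rw [mul_inv, mul_inv, inv_inv, inv_neg, Complex.inv_I]
  ring

theorem exists_lowLoss (hη : S.η.PosDef) (hgen_dual : (S.dual hη).Generic) :
    ∃ (ζ : Fin S.rankR → ℂ → ℂ)
        (P : Fin S.rankR → ℂ → Matrix (Fin N ⊕ Fin N) (Fin N ⊕ Fin N) ℂ),
      S.IsLowLossLowQFamily ζ ∧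
      (∀ j, AnalyticOnNhd ℂ (ζ j) (Metric.ball 0 (S.beta1 hη)⁻¹)) ∧
      (∀ j, (∀ a b, AnalyticOnNhd ℂ (fun z => P j z a b) (Metric.ball 0 (S.beta1 hη)⁻¹)) ∧
        ∀ z ∈ Metric.ball (0 : ℂ) (S.beta1 hη)⁻¹, (P j z).rank = 1) ∧
      (∀ j, ∀ z ∈ Metric.ball (0 : ℂ) (S.beta1 hη)⁻¹ \ {0},
        IsSimpleEigenvalue (S.A z⁻¹) (ζ j z) ∧ IsEigenprojection (S.A z⁻¹) (ζ j z) (P j z)) ∧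
      (∀ j, ∀ β : ℝ, S.beta1 hη < β →
        IsSimpleEigenvalue (S.A (β : ℂ)) (ζ j ((β : ℂ)⁻¹)) ∧ (ζ j ((β : ℂ)⁻¹)).re = 0) := by
  have hω : 0 < (S.dual hη).omegaMax := (S.dual hη).omegaMax_pos S.α_pos
  have hβ0 := (S.dual hη).beta0_pos hω
  have hβle : (S.dual hη).beta0 ≤ S.beta1 hη := le_max_right _ _
  have hβ1 := hβ0.trans_le hβle
  have hsub : ball (0 : ℂ) (S.beta1 hη)⁻¹ ⊆ ball 0 (S.dual hη).beta0⁻¹ :=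
    ball_subset_ball (inv_anti₀ hβ0 hβle)
  obtain ⟨μ, hd, hs, hinj, hlt, hall, hre⟩ :
    ∃ μ : Fin S.rankR → ℂ → ℂ, _ := (S.dual hη).exists_pencil_eigenvalues hω hgen_dual
  have hμ0 : ∀ j, ∀ z ∈ ball (0 : ℂ) (S.dual hη).beta0⁻¹, μ j z ≠ 0 := by
    intro j z hz
    exact norm_pos_iff.1 ((half_pos (S.dual hη).gap_pos).trans (hlt j z hz).2)
  have han : ∀ j, AnalyticOnNhd ℂ (μ j) (ball 0 (S.dual hη).beta0⁻¹) :=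
    fun j => (hd j).analyticOnNhd isOpen_ball
  have hζ : ∀ j, AnalyticOnNhd ℂ (fun z => -Complex.I * z * (μ j z)⁻¹)
      (ball 0 (S.beta1 hη)⁻¹) := fun j z hz =>
    (analyticAt_const.mul analyticAt_id).mul ((han j z (hsub hz)).inv (hμ0 j z (hsub hz)))
  have h0 : (0 : ℂ) ∈ ball (0 : ℂ) (S.beta1 hη)⁻¹ := mem_ball_self (inv_pos.2 hβ1)
  have hsimple : ∀ j, ∀ z ∈ ball (0 : ℂ) (S.beta1 hη)⁻¹ \ {0},
      IsSimpleEigenvalue (S.A z⁻¹) (-Complex.I * z * (μ j z)⁻¹) := by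
    intro j z hz
    rw [← neg_inv_neg_I_mul]
    exact S.isSimpleEigenvalue_of_dual hη
      ((S.dual hη).isSimpleEigenvalue_A hz.2 (hs j z (hsub hz.1)))
  refine ⟨fun j z => -Complex.I * z * (μ j z)⁻¹,
    fun j z => swapBlocks (adjugateProj ((S.dual hη).pencil z) (μ j z)),
    ⟨?_, (S.dual hη).omegaMax⁻¹, inv_pos.2 hω, ?_⟩, hζ, ?_, ?_, ?_⟩
  · intro j
    have h := (hζ j 0 h0).continuousAt.tendsto.comp tendsto_ofReal_inv
    simpa [Function.comp_def] using h
  · filter_upwards [eventually_gt_atTop (S.dual hη).beta0] with β hβ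
    have hz := inv_mem_ball hβ0 hβ
    have h := (S.dual hη).roots_filter_A hz.2 (fun j => hs j _ hz.1) (hinj _ hz.1)
      (fun j => (hlt j _ hz.1).1) (hall _ hz.1)
    rw [inv_inv] at h
    have hne : ∀ r ∈ ((S.dual hη).A β).charpoly.roots, r ≠ 0 := by
      rintro r hr rfl
      have hdet : ((S.dual hη).A β).det = 0 := by
        rw [Matrix.det_eq_prod_roots_charpoly]
        exact Multiset.prod_eq_zero hr
      have h1 := congrArg Matrix.det (S.A_dual_mul hη β)
      rw [Matrix.det_mul, hdet, zero_mul, Matrix.det_neg, Matrix.det_one, mul_one] at h1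
      exact pow_ne_zero _ (by norm_num) h1.symm
    rw [S.roots_charpoly_A_eq_dual hη, Multiset.filter_map]
    have h2 : ((S.dual hη).A β).charpoly.roots.filter
        ((fun x => ‖x‖ < (S.dual hη).omegaMax⁻¹) ∘ (fun r => -r⁻¹))
        = ((S.dual hη).A β).charpoly.roots.filter (fun x => (S.dual hη).omegaMax < ‖x‖) := by
      apply Multiset.filter_congr
      intro r hr
      rw [Function.comp, norm_neg, norm_inv, inv_lt_inv₀ (norm_pos_iff.2 (hne r hr)) hω]
    rw [h2, h, Multiset.map_map]
    apply Multiset.map_congr rfl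
    intro j _
    have := neg_inv_neg_I_mul (β : ℂ)⁻¹ (μ j (β : ℂ)⁻¹)
    rw [inv_inv] at this
    exact this
  · intro j
    refine ⟨fun a b z hz => ?_, fun z hz => ?_⟩
    · exact (differentiableOn_adjugateProj (hd j) (hs j) a.swap b.swap).analyticOnNhd
        isOpen_ball z (hsub hz)
    · refine (Matrix.rank_reindex _ _ _).trans ?_
      exact rank_adjugateProj (hs j z (hsub hz))
  · intro j z hz
    refine ⟨hsimple j z hz, ?_⟩
    have hs' := hs j z (hsub hz.1)
    have hA := (S.dual hη).A_inv_eq_smul_pencil hz.2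
    simp only [← neg_inv_neg_I_mul]
    refine S.isEigenprojection_of_dual hη ?_ ((S.dual hη).isSimpleEigenvalue_A hz.2 hs')
      (adjugateProj_ne_zero hs') (adjugateProj_mul_self hs') ?_ ?_
    · exact mul_ne_zero (mul_ne_zero (neg_ne_zero.2 Complex.I_ne_zero) (inv_ne_zero hz.2))
        (hμ0 j z (hsub hz.1))
    · rw [hA, Matrix.smul_mul, mul_adjugateProj hs', smul_smul]
    · rw [hA, Matrix.mul_smul, adjugateProj_mul hs', smul_smul]
  · intro j β hβ
    have hz := inv_mem_ball hβ1 hβ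
    have h := hsimple j _ hz
    rw [inv_inv] at h
    refine ⟨h, ?_⟩
    have him := hre j β⁻¹ (by rw [Complex.ofReal_inv]; exact hsub hz.1)
    rw [Complex.ofReal_inv] at him
    simp [Complex.mul_re, Complex.inv_im, him]

end LagrangianSystem

end

theorem mainTheorem4 {N : ℕ} (S : LagrangianSystem N) (hη : S.η.PosDef)
    (hgen : S.Generic) (hgen_dual : (S.dual hη).Generic) :
    -- the high-loss eigenvalues
    (∃ (ζ : Fin S.rankR → ℂ → ℂ)
        (P : Fin S.rankR → ℂ → Matrix (Fin N ⊕ Fin N) (Fin N ⊕ Fin N) ℂ),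
      S.IsHighLossFamily ζ ∧
      (∀ j, MeromorphicAt (ζ j) 0 ∧
        AnalyticOnNhd ℂ (ζ j) (Metric.ball 0 (S.beta0)⁻¹ \ {0})) ∧
      (∀ j, (∀ a b, AnalyticOnNhd ℂ (fun z => P j z a b) (Metric.ball 0 (S.beta0)⁻¹)) ∧
        ∀ z ∈ Metric.ball (0 : ℂ) (S.beta0)⁻¹, (P j z).rank = 1) ∧
      (∀ j, ∀ z ∈ Metric.ball (0 : ℂ) (S.beta0)⁻¹ \ {0},
        IsSimpleEigenvalue (S.A z⁻¹) (ζ j z) ∧ IsEigenprojection (S.A z⁻¹) (ζ j z) (P j z)) ∧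
      (∀ j, ∀ β : ℝ, S.beta0 < β → (ζ j ((β : ℂ)⁻¹)).re = 0)) ∧
    -- the low-loss/low-Q eigenvalues
    (∃ (ζ : Fin S.rankR → ℂ → ℂ)
        (P : Fin S.rankR → ℂ → Matrix (Fin N ⊕ Fin N) (Fin N ⊕ Fin N) ℂ),
      S.IsLowLossLowQFamily ζ ∧
      (∀ j, AnalyticOnNhd ℂ (ζ j) (Metric.ball 0 (S.beta1 hη)⁻¹)) ∧
      (∀ j, (∀ a b, AnalyticOnNhd ℂ (fun z => P j z a b) (Metric.ball 0 (S.beta1 hη)⁻¹)) ∧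
        ∀ z ∈ Metric.ball (0 : ℂ) (S.beta1 hη)⁻¹, (P j z).rank = 1) ∧
      (∀ j, ∀ z ∈ Metric.ball (0 : ℂ) (S.beta1 hη)⁻¹ \ {0},
        IsSimpleEigenvalue (S.A z⁻¹) (ζ j z) ∧ IsEigenprojection (S.A z⁻¹) (ζ j z) (P j z)) ∧
      (∀ j, ∀ β : ℝ, S.beta1 hη < β →
        IsSimpleEigenvalue (S.A (β : ℂ)) (ζ j ((β : ℂ)⁻¹)) ∧ (ζ j ((β : ℂ)⁻¹)).re = 0)) := by
  exact ⟨S.exists_highLoss hη hgen, S.exists_lowLoss hη hgen_dual⟩
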